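/- Let $\mathbb X,\mathbb W,\mathbb Z$ be Polish spaces with their Borel $\sigma$-algebras. Let $\Phi=\sum_{j=1}^{M}\delta_{X_j}$ be a simple point process on $\mathbb X$ with $M<\infty$ almost surely, $H$ a probability measure on $(0,\infty)$, $F$ a probability measure on $\mathbb W$ and $f(\mathrm dz\mid x,w)$ a probability kernel from $\mathbb X\times\mathbb W$ to $\mathbb Z$. Attach to the points of $\Phi$ i.i.d. jumps $S_j\sim H$ and i.i.d. marks $W_j\sim F$ (all independent, and independent of $\Phi$), and set $\tilde\mu=\sum_{j=1}^M S_j\,\delta_{(X_j,W_j)}$ and $T=\sum_{j=1}^M S_j$. Let $n\ge 1$ and consider the hierarchical mixture model in which, given $\tilde\mu$ with $T>0$, the component labels $J_1,\dots,J_n$ are i.i.d. with $\mathsf P(J_i=j\mid\tilde\mu)=S_j/T$, the auxiliary variable $U_n$ is $\mathrm{Gamma}(n,T)$ (shape $n$, rate $T$) and independent of the labels, and the observations $Z_i\sim f(\cdot\mid X_{J_i},W_{J_i})$ are independent; no observation is generated if $T=0$, and everything below is on the event $T>0$. Let $K_n$ be the number of distinct labels among $J_1,\dots,J_n$, relabel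 the components so that the active ones (those with some $J_i=j$) are $1,\dots,K_n$ in order of appearance, let $C_1,\dots,C_n\in\{1,\dots,K_n\}$ be the resulting allocations, $\bm X^{(a)}=(X^{(a)}_1,\dots,X^{(a)}_{K_n})$ and $\bm W^{(a)}=(W^{(a)}_1,\dots,W^{(a)}_{K_n})$ the active atoms and their marks, and $n_h=\#\{i: C_i=h\}$. For $k\ge 0$ let $M_{\Phi^{(k)}}$ be the $k$-th factorial moment measure of $\Phi$ and assume that it is $\sigma$-finite. Then reduced Palm distributions $\{\mathbf P^{\bm x}_{\Phi^!}\}_{\bm x\in\mathbb X^k}$ of order $k$ of $\Phi$ exist, that is, a probability kernel such that for all measurable sets $B$ of $\mathbb X^k$ and $L$ of measures on $\mathbb X$, $$\mathsf E\Big[\sum_{(a_1,\dots,a_k)}^{\neq}\mathbf 1_B(X_{a_1},\dots,X_{a_k})\,\mathbf 1_L\Big(\Phi-\sum_{i=1}^k\delta_{X_{a_i}}\Big)\Big]=\int_B\mathbf P^{\bm x}_{\Phi^!}(L)\,M_{\Phi^{(k)}}(\mathrm d\bm x),$$ the sum being over all $k$-tuples of pairwise different indices in $\{1,\dots,M\}$.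 For every version of them, let $\tilde\mu^!_{\bm x}=\sum_j S_j'\delta_{X_j'}$, where $\sum_j\delta_{X_j'}\sim\mathbf P^{\bm x}_{\Phi^!}$ and the $S_j'$ are i.i.d. with law $H$ and independent of it. Then, for almost every value of the conditioning variables, a regular conditional distribution of $\tilde\mu$ given $C_1,\dots,C_n$, $K_n=k$, $\bm X^{(a)}=\bm x$, $\bm W^{(a)}=\bm w$ and $U_n=u$ is the law of $$\sum_{h=1}^k S^{(a)}_h\,\delta_{(x_h,w_h)}+\tilde\mu',\qquad \tilde\mu'=\sum_{h\ge1}S^{(na)}_h\,\delta_{(X^{(na)}_h,W^{(na)}_h)},$$ where $S^{(a)}_1,\dots,S^{(a)}_k$ and $\tilde\mu'$ are independent; $S^{(a)}_h$ has the law proportional to $s^{n_h}e^{-us}H(\mathrm ds)$; and $\tilde\mu'$ is obtained by adding i.i.d. marks $W^{(na)}_h\sim F$ to the distinct support points $X_h^{(na)}$, carrying masses $S_h^{(na)}>0$, of a random measure $\mu'=\sum_{h\ge1}S^{(na)}_h\delta_{X^{(na)}_h}$ on $\mathbb X$ with finitely many atoms and with Laplace functional $$\mathsf E\Big[e^{-\int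 g\,\mathrm d\mu'}\Big]=\frac{\mathsf E\big[e^{-\int (g(z)+u)\,\tilde\mu^!_{\bm x}(\mathrm dz)}\big]}{\mathsf E\big[e^{-\int u\,\tilde\mu^!_{\bm x}(\mathrm dz)}\big]}\qquad\text{for all measurable } g:\mathbb X\to[0,\infty).$$ -/

import Mathlib

open MeasureTheory ProbabilityTheory
open scoped NNReal ENNReal

noncomputable section

namespace MixtureModel

/-! ### Finite point processes, marks and random measures -/

/-- An enumerated finite configuration `(m, x)` of points of `E`: its points are
`x 0, …, x (m - 1)`, the entries `x j` with `m ≤ j` are irrelevant.  The law of a finite point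
process is given by the law of any enumeration of its points. -/
abbrev Config (E : Type*) := ℕ × (ℕ → E)

variable {E S 𝕏 𝕎 Z : Type*} [MeasurableSpace E] [MeasurableSpace S] [MeasurableSpace 𝕏]
  [MeasurableSpace 𝕎] [MeasurableSpace Z]

/-- The counting measure `∑ j < m, δ_{x j}` of a configuration. -/
def counting (c : Config E) : Measure E :=
  ∑ j ∈ Finset.range c.1, Measure.dirac (c.2 j)

/-- The point process is simple: almost surely its points are pairwise distinct. -/
def IsSimple (Φ : Measure (Config E)) : Prop :=
  ∀ᵐ c ∂Φ, Set.InjOn c.2 (Set.Iio c.1)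

/-- Attach to the points of a finite point process with law `Φ` i.i.d. marks with law `H`,
independent of the points. -/
def mark (Φ : Measure (Config E)) (H : Measure S) [IsProbabilityMeasure H] :
    Measure (Config (E × S)) :=
  (Φ.prod (Measure.infinitePi fun _ : ℕ => H)).map
    fun p => (p.1.1, fun j => (p.1.2 j, p.2 j))

/-- The measure `∑ j < m, s j • δ_{x j}` on `𝕏`. -/
def atomic (c : Config (𝕏 × ℝ≥0)) : Measure 𝕏 :=
  ∑ j ∈ Finset.range c.1, ((c.2 j).2 : ℝ≥0∞) • Measure.dirac (c.2 j).1

/-- The measure `∑ j < m, s j • δ_{(x j, w j)}` on `𝕏 × 𝕎`. -/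
def markedAtomic (c : Config ((𝕏 × ℝ≥0) × 𝕎)) : Measure (𝕏 × 𝕎) :=
  ∑ j ∈ Finset.range c.1,
    ((c.2 j).1.2 : ℝ≥0∞) • Measure.dirac ((c.2 j).1.1, (c.2 j).2)

/-- The total mass `∑ j < m, s j`. -/
def totalMass (c : Config ((𝕏 × ℝ≥0) × 𝕎)) : ℝ≥0 :=
  ∑ j ∈ Finset.range c.1, (c.2 j).1.2

/-- The Laplace functional at `f` of a random measure with law `Q`. -/
def laplace (Q : Measure (Measure 𝕏)) (f : 𝕏 → ℝ) : ℝ :=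
  ∫ μ, Real.exp (-∫ x, f x ∂μ) ∂Q

/-! ### Palm distributions -/

/-- The `k`-th factorial moment measure of a point process with law `Φ`:
`B ↦ E[∑ 1_B (X_{a 1}, …, X_{a k})]`, the sum over all `k`-tuples of pairwise different indices
of points of the configuration. -/
def factorialMoment (Φ : Measure (Config E)) (k : ℕ) : Measure (Fin k → E) :=
  Measure.sum fun a : Fin k ↪ ℕ =>
    (Φ.restrict {c | ∀ i, a i < c.1}).map fun c i => c.2 (a i)

/-- The `k`-th reduced Campbell measure:
`C ↦ E[∑ 1_C ((X_{a 1}, …, X_{a k}), Φ - ∑ i, δ_{X_{a i}})]`, with the same sum. -/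
def reducedCampbell (Φ : Measure (Config E)) (k : ℕ) : Measure ((Fin k → E) × Measure E) :=
  Measure.sum fun a : Fin k ↪ ℕ =>
    (Φ.restrict {c | ∀ i, a i < c.1}).map fun c =>
      (fun i => c.2 (a i),
        ∑ j ∈ Finset.range c.1 \ Finset.univ.map a, Measure.dirac (c.2 j))

/-- `P` is a version of the `k`-th reduced Palm kernel of the point process with law `Φ`: the law
under `P x` of the counting measure of the configuration disintegrates the reduced Campbell
measure with respect to the factorial moment measure. -/
structure IsReducedPalm (Φ : Measure (Config E)) (k : ℕ)
    (P : Kernel (Fin k → E) (Config E)) : Prop where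
  markov : IsMarkovKernel P
  campbell : ∀ (B : Set (Fin k → E)) (L : Set (Measure E)), MeasurableSet B → MeasurableSet L →
    reducedCampbell Φ k (B ×ˢ L) =
      ∫⁻ x in B, P x {c | counting c ∈ L} ∂(factorialMoment Φ k)

/-! ### The kernels of the hierarchical model -/

/-- The kernel of independent coordinates with laws `κ i a`. -/
def piKernel {n : ℕ} {α β : Type*} [MeasurableSpace α] [MeasurableSpace β]
    (κ : Fin n → Kernel α β) [∀ i, IsFiniteKernel (κ i)] : Kernel α (Fin n → β) where
  toFun a := Measure.pi fun i => κ i a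
  measurable' := by
    refine Measurable.measure_of_isPiSystem generateFrom_pi.symm isPiSystem_pi ?_ ?_
    · rintro _ ⟨s, hs, rfl⟩
      simp only [Measure.pi_pi]
      exact Finset.measurable_prod _ fun i _ => (κ i).measurable_coe (hs i (Set.mem_univ i))
    · simp only [Measure.pi_univ]
      exact Finset.measurable_prod _ fun i _ => (κ i).measurable_coe MeasurableSet.univ

instance {n : ℕ} {α β : Type*} [MeasurableSpace α] [MeasurableSpace β]
    (κ : Fin n → Kernel α β) [∀ i, IsFiniteKernel (κ i)] : IsFiniteKernel (piKernel κ) := by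
  refine ⟨∏ i, (κ i).bound, ?_, fun a => ?_⟩
  · exact ENNReal.prod_lt_top fun i _ => (κ i).bound_lt_top
  · change Measure.pi (fun i => κ i a) Set.univ ≤ _
    rw [Measure.pi_univ]
    exact Finset.prod_le_prod' fun i _ => (κ i).measure_le_bound a _

theorem measurable_of_index {α β : Type*} [MeasurableSpace α] [MeasurableSpace β]
    {m : α → ℕ} (hm : Measurable m) {g : ℕ → α → β} (hg : ∀ j, Measurable (g j)) :
    Measurable fun a => g (m a) a :=
  (measurable_from_prod_countable_right (f := fun p : ℕ × α => g p.1 p.2) hg).comp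
    (hm.prodMk measurable_id)

theorem measurable_totalMass : Measurable (totalMass : Config ((𝕏 × ℝ≥0) × 𝕎) → ℝ≥0) :=
  measurable_of_index (g := fun m (c : Config ((𝕏 × ℝ≥0) × 𝕎)) =>
    ∑ j ∈ Finset.range m, (c.2 j).1.2) measurable_fst
    fun _ => Finset.measurable_sum _ fun _ _ => by fun_prop

/-- The categorical distribution on the component labels `0, …, m - 1` with probabilities
`s j / T`.  It is the zero measure when `T = 0`: no observation is generated then. -/
def categorical : Kernel (Config ((𝕏 × ℝ≥0) × 𝕎)) ℕ where
  toFun c := ∑ j ∈ Finset.range c.1,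
    (((c.2 j).1.2 : ℝ≥0∞) / (totalMass c : ℝ≥0∞)) • Measure.dirac j
  measurable' := by
    refine Measure.measurable_of_measurable_coe _ fun s hs => ?_
    simp only [Measure.coe_finsetSum, Finset.sum_apply, Measure.smul_apply, smul_eq_mul]
    refine measurable_of_index (g := fun m (c : Config ((𝕏 × ℝ≥0) × 𝕎)) =>
      ∑ j ∈ Finset.range m,
        ((c.2 j).1.2 : ℝ≥0∞) / (totalMass c : ℝ≥0∞) * Measure.dirac j s) measurable_fst
      fun m => Finset.measurable_sum _ fun j _ => ?_
    have h := (measurable_totalMass (𝕏 := 𝕏) (𝕎 := 𝕎)).coe_nnreal_ennreal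
    exact (Measurable.div (by fun_prop) h).mul_const _

instance : IsFiniteKernel (categorical : Kernel (Config ((𝕏 × ℝ≥0) × 𝕎)) ℕ) := by
  refine ⟨1, ENNReal.one_lt_top, fun c => ?_⟩
  change (∑ j ∈ Finset.range c.1, (((c.2 j).1.2 : ℝ≥0∞) / (totalMass c : ℝ≥0∞)) •
    (Measure.dirac j : Measure ℕ)) Set.univ ≤ 1
  simp only [Measure.coe_finsetSum, Finset.sum_apply, Measure.smul_apply, smul_eq_mul,
    measure_univ, mul_one, div_eq_mul_inv]
  rw [← Finset.sum_mul, totalMass, ENNReal.ofNNReal_finsetSum]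
  exact ENNReal.mul_inv_le_one _

theorem measurable_gammaDensity (n : ℕ) :
    Measurable (Function.uncurry fun (c : Config ((𝕏 × ℝ≥0) × 𝕎)) (x : ℝ) =>
      gammaPDF n (totalMass c) x) := by
  have hT : Measurable fun p : Config ((𝕏 × ℝ≥0) × 𝕎) × ℝ => (totalMass p.1 : ℝ) :=
    (measurable_totalMass.comp measurable_fst).coe_nnreal_real
  unfold gammaPDF gammaPDFReal
  refine ENNReal.measurable_ofReal.comp (Measurable.ite
    (measurableSet_le measurable_const measurable_snd) ?_ measurable_const)
  exact (((hT.pow_const _).div_const _).mul (measurable_snd.pow_const _)).mul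
    (Real.measurable_exp.comp (hT.mul measurable_snd).neg)

/-- The conditional law `Gamma (n, T)` (shape `n`, rate `T`) of the auxiliary variable. -/
def gammaKernel (n : ℕ) : Kernel (Config ((𝕏 × ℝ≥0) × 𝕎)) ℝ where
  toFun c := gammaMeasure n (totalMass c)
  measurable' := by
    have e : (fun c : Config ((𝕏 × ℝ≥0) × 𝕎) => gammaMeasure n (totalMass c)) =
        fun c => Kernel.withDensity (Kernel.const _ volume)
          (fun (c : Config ((𝕏 × ℝ≥0) × 𝕎)) (x : ℝ) => gammaPDF n (totalMass c) x) c := by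
      funext c
      rw [Kernel.withDensity_apply _ (measurable_gammaDensity n)]
      rfl
    rw [e]
    exact Kernel.measurable _

instance (n : ℕ) : IsSFiniteKernel (gammaKernel n : Kernel (Config ((𝕏 × ℝ≥0) × 𝕎)) ℝ) := by
  have e : (gammaKernel n : Kernel (Config ((𝕏 × ℝ≥0) × 𝕎)) ℝ) =
      Kernel.withDensity (Kernel.const _ volume)
        (fun (c : Config ((𝕏 × ℝ≥0) × 𝕎)) (x : ℝ) => gammaPDF n (totalMass c) x) := by
    ext1 c
    rw [Kernel.withDensity_apply _ (measurable_gammaDensity n)]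
    rfl
  rw [e]
  exact Kernel.IsSFiniteKernel.withDensity _ fun _ _ => ENNReal.ofReal_ne_top

theorem measurable_component {n : ℕ} (i : Fin n) :
    Measurable fun q : (Config ((𝕏 × ℝ≥0) × 𝕎) × (Fin n → ℕ)) × ℝ =>
      ((q.1.1.2 (q.1.2 i)).1.1, (q.1.1.2 (q.1.2 i)).2) :=
  measurable_of_index (g := fun j (q : (Config ((𝕏 × ℝ≥0) × 𝕎) × (Fin n → ℕ)) × ℝ) =>
    ((q.1.1.2 j).1.1, (q.1.1.2 j).2)) (by fun_prop) fun _ => by fun_prop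

/-! ### The hierarchical mixture model -/

/-- A sample point `(((c, J), u), z)`: the configuration `c` of the triples
`((X j, S j), W j)`, the labels `J i` of the components to which the observations are allocated,
the auxiliary variable `u`, and the observations `z i`. -/
abbrev Sample (𝕏 𝕎 Z : Type*) (n : ℕ) :=
  ((Config ((𝕏 × ℝ≥0) × 𝕎) × (Fin n → ℕ)) × ℝ) × (Fin n → Z)

/-- The joint law of the hierarchical mixture model: the points have law `Φ`, the jumps are
i.i.d. `H`, the marks are i.i.d. `F`, the labels are i.i.d. categorical with probabilities
`S j / T`, the auxiliary variable is `Gamma (n, T)` and independent of the labels given the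
configuration, and the observations are independent with laws `f (X_{J i}, W_{J i})`.  On the
event `T = 0` no observation is generated, so that the total mass is the prior probability
of `T > 0`. -/
def model (Φ : Measure (Config 𝕏)) (H : Measure ℝ≥0) [IsProbabilityMeasure H]
    (F : Measure 𝕎) [IsProbabilityMeasure F] (f : Kernel (𝕏 × 𝕎) Z) [IsMarkovKernel f] (n : ℕ) :
    Measure (Sample 𝕏 𝕎 Z n) :=
  (((mark (mark Φ H) F) ⊗ₘ (piKernel fun _ : Fin n => categorical)) ⊗ₘ
      ((gammaKernel n).comap Prod.fst measurable_fst)) ⊗ₘ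
    (piKernel fun i : Fin n => f.comap _ (measurable_component i))

/-- The distinct component labels to which observations are allocated (the labels of the active
components), in order of appearance. -/
def activeLabels {n : ℕ} (J : Fin n → ℕ) : List ℕ := (List.ofFn J).reverse.dedup.reverse

/-- The number `K_n` of active components. -/
def numActive {n : ℕ} (J : Fin n → ℕ) : ℕ := (activeLabels J).length

/-- The allocations `C i`, after the components have been relabelled so that the active ones
are the components `0, …, K_n - 1`. -/
def alloc {n : ℕ} (J : Fin n → ℕ) : Fin n → ℕ := fun i => (activeLabels J).idxOf (J i)

/-- The number `n_h` of observations allocated to the component `h`. -/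
def clusterSize {n : ℕ} (C : Fin n → ℕ) (h : ℕ) : ℕ := (Finset.univ.filter fun i => C i = h).card

/-- On the event `K_n = k`: the conditioning variables, that is the allocations, the active atoms,
their marks, and the auxiliary variable. -/
def conditioning {n : ℕ} (k : ℕ) (ω : Sample 𝕏 𝕎 Z n) :
    (Fin n → ℕ) × (Fin k → 𝕏) × (Fin k → 𝕎) × ℝ :=
  (alloc ω.1.1.2,
    fun h => (ω.1.1.1.2 ((activeLabels ω.1.1.2).getD h 0)).1.1,
    fun h => (ω.1.1.1.2 ((activeLabels ω.1.1.2).getD h 0)).2,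
    ω.1.2)

/-- The random measure `∑ j, S j • δ_{(X j, W j)}`. -/
def randomMeasure {n : ℕ} (ω : Sample 𝕏 𝕎 Z n) : Measure (𝕏 × 𝕎) := markedAtomic ω.1.1.1

/-- The law of the model on the event `K_n = k`. -/
def modelOn (Φ : Measure (Config 𝕏)) (H : Measure ℝ≥0) [IsProbabilityMeasure H]
    (F : Measure 𝕎) [IsProbabilityMeasure F] (f : Kernel (𝕏 × 𝕎) Z) [IsMarkovKernel f]
    (n k : ℕ) : Measure (Sample 𝕏 𝕎 Z n) :=
  (model Φ H F f n).restrict {ω | numActive ω.1.1.2 = k}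

/-! ### The posterior -/

/-- The law of an active jump, the probability measure proportional to
`s ^ m * exp (-u s) H(ds)`. -/
def jumpLaw (H : Measure ℝ≥0) (u : ℝ) (m : ℕ) : Measure ℝ≥0 :=
  (∫⁻ s, ENNReal.ofReal ((s : ℝ) ^ m * Real.exp (-(u * s))) ∂H)⁻¹ •
    H.withDensity fun s => ENNReal.ofReal ((s : ℝ) ^ m * Real.exp (-(u * s)))

/-- `τ` is the law of (an enumeration of the distinct atoms, with their positive masses, of) the
random measure `μ'` on `𝕏` with Laplace functional
`f ↦ E[exp (-∫ (f + u) dμ!)] / E[exp (-∫ u dμ!)]`, where `μ!` is the random measure obtained from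
the point process with law `R` by attaching i.i.d. jumps with law `H`. -/
structure IsNonActive (R : Measure (Config 𝕏)) (H : Measure ℝ≥0) [IsProbabilityMeasure H] (u : ℝ)
    (τ : Measure (Config (𝕏 × ℝ≥0))) : Prop where
  prob : IsProbabilityMeasure τ
  atoms : ∀ᵐ c ∂τ, Set.InjOn (fun j => (c.2 j).1) (Set.Iio c.1) ∧ ∀ j < c.1, 0 < (c.2 j).2
  laplace_eq : ∀ f : 𝕏 → ℝ, Measurable f → (∀ x, 0 ≤ f x) →
    laplace (τ.map atomic) f =
      laplace ((mark R H).map atomic) (fun x => f x + u) /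
        laplace ((mark R H).map atomic) (fun _ => u)

/-- The law of `∑ h, S h • δ_{(x h, w h)} + μ'`, where the `S h` are independent with laws
`jumpLaw H u (m h)`, and `μ'`, independent of them, is obtained from `τ` by attaching i.i.d. marks
with law `F` to the atoms. -/
def posterior {k : ℕ} (H : Measure ℝ≥0) (F : Measure 𝕎) [IsProbabilityMeasure F]
    (m : Fin k → ℕ) (x : Fin k → 𝕏) (w : Fin k → 𝕎) (u : ℝ) (τ : Measure (Config (𝕏 × ℝ≥0))) :
    Measure (Measure (𝕏 × 𝕎)) :=
  ((Measure.pi fun h => jumpLaw H u (m h)).prod (mark τ F)).map fun p =>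
    (∑ h, (p.1 h : ℝ≥0∞) • Measure.dirac (x h, w h)) + markedAtomic p.2

end MixtureModel

end

set_option linter.unusedSectionVars false

namespace MixtureModel

/-! ### Product measures -/

section ProductMeasures

variable {S : Type*} [MeasurableSpace S]

/-! The auxiliary variable makes the likelihood factorize over components. Label vectors with `k`
distinct values correspond to pairs of an allocation `C` and an injection `a` naming the active
components (`Allocation.labelsEquiv`). Given the configuration, such labels have probability `∏ S_{a
h} ^ n_h / T ^ n`, and the gamma density of `U_n` is `T ^ n u ^ (n - 1) exp (-u T) / Γ(n)`. The
powers of `T` cancel, and `exp (-u T)` splits into a factor `S ^ n_h exp (-u S)` for each active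
jump and a factor `exp (-u S)` for each remaining one (`prod_categorical_mul_gammaPDF`).

Jumps and marks are i.i.d., so those at the indices `a` are independent of those at the
complementary indices (`lintegral_marks_split`). The sum over `a` is then an integral against a
Campbell measure (`lintegral_labels`), which the Palm kernel disintegrates. The result,
`lintegral_modelOn`, writes the joint law of the conditioning variables and the random measure as a
mixture of the unnormalized posteriors `posteriorWeight` over allocations, the factorial moment
measure, `u ^ (n - 1) du / Γ(n)` and `F ^ k`. Normalizing inside the mixture gives the conditional
law (`posteriorWeight_eq_mul_lintegral`, `map_modelOn_eq_compProd`).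

One point is delicate: a Palm kernel is prescribed only through the law of the counting measure,
whereas integrands are functions of an enumeration. The integrands used are invariant under
re-enumeration, because permuting i.i.d. jumps and marks preserves their law (`configWeight_congr`).
By a Lusin separation argument, an invariant measurable function is measurable for the σ-algebra
generated by the counting measure (`measurableSet_comap_counting`), so every version of the Palm
kernel gives the same integral.

The non-active part is the marked Palm process tilted by `exp (-u ∑ s)`. Tilting shifts the argument
of the Laplace functional by `u`, which is the required ratio (`isNonActive_nonActive`). Its atoms
are distinct because almost every Palm distribution of a simple process is simple
(`IsReducedPalm.ae_isSimple`). -/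

theorem infinitePi_map_comp {ι ι' : Type*} (H : Measure S) [IsProbabilityMeasure H]
    {g : ι → ι'} (hg : Function.Injective g) :
    (Measure.infinitePi fun _ : ι' => H).map (fun s i => s (g i)) =
      Measure.infinitePi fun _ : ι => H := by
  classical
  refine Measure.eq_infinitePi _ fun s t ht => ?_
  rw [Measure.map_apply (by fun_prop)
    (MeasurableSet.pi s.countable_toSet fun i _ => ht i)]
  -- The preimage of a cylinder is a cylinder over the image indices; outside the range of `g` the
  -- factor is the whole space.
  have e : (fun (s : ι' → S) (i : ι) => s (g i)) ⁻¹' ((s : Set ι).pi t) =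
      ((s.image g : Finset ι') : Set ι').pi
        (fun i' => if h : ∃ i, g i = i' then t h.choose else Set.univ) := by
    ext x
    simp only [Set.mem_preimage, Set.mem_pi, Finset.coe_image, Set.forall_mem_image]
    refine forall₂_congr fun i _ => ?_
    have h : ∃ j, g j = g i := ⟨i, rfl⟩
    rw [dif_pos h, hg h.choose_spec]
  rw [e, Measure.infinitePi_pi, Finset.prod_image fun _ _ _ _ h => hg h]
  · refine Finset.prod_congr rfl fun i _ => ?_
    have h : ∃ j, g j = g i := ⟨i, rfl⟩
    rw [dif_pos h, hg h.choose_spec]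
  · intro i' _
    split_ifs with h
    exacts [ht _, MeasurableSet.univ]

theorem pi_prod_infinitePi_map_sumElim {ι ι' : Type*} [Fintype ι] (H : Measure S)
    [IsProbabilityMeasure H] :
    ((Measure.pi fun _ : ι => H).prod (Measure.infinitePi fun _ : ι' => H)).map
      (fun p => Sum.elim p.1 p.2) = Measure.infinitePi fun _ : ι ⊕ ι' => H := by
  have hm : Measurable fun p : (ι → S) × (ι' → S) => (Sum.elim p.1 p.2 : ι ⊕ ι' → S) := by
    refine measurable_pi_lambda _ fun i => ?_
    cases i <;> simp only [Sum.elim_inl, Sum.elim_inr] <;> fun_prop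
  refine Measure.eq_infinitePi _ fun s t ht => ?_
  rw [Measure.map_apply hm (MeasurableSet.pi s.countable_toSet fun i _ => ht i)]
  have e : (fun p : (ι → S) × (ι' → S) => (Sum.elim p.1 p.2 : ι ⊕ ι' → S)) ⁻¹'
      ((s : Set (ι ⊕ ι')).pi t) =
      ((s.toLeft : Set ι).pi fun i => t (.inl i)) ×ˢ
        ((s.toRight : Set ι').pi fun i => t (.inr i)) := by
    ext p
    simp [Set.mem_pi]
  rw [e, Measure.prod_prod, ← Measure.infinitePi_eq_pi,
    Measure.infinitePi_pi _ fun i _ => ht _, Measure.infinitePi_pi _ fun i _ => ht _,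
    ← Finset.prod_disjSum _ _ fun i => H (t i), Finset.toLeft_disjSum_toRight]

/-- Subfamilies of an i.i.d. sequence along disjoint index sets are independent and again i.i.d. The
indices need not exhaust `ℕ`. -/
theorem lintegral_infinitePi_split {ι ι' : Type*} [Fintype ι] (H : Measure S)
    [IsProbabilityMeasure H] {a : ι → ℕ} {b : ι' → ℕ}
    (hab : Function.Injective (Sum.elim a b)) {G : (ι → S) → (ι' → S) → ℝ≥0∞}
    (hG : Measurable (Function.uncurry G)) :
    ∫⁻ s, G (fun i => s (a i)) (fun j => s (b j)) ∂(Measure.infinitePi fun _ : ℕ => H) =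
      ∫⁻ s, ∫⁻ s', G s s' ∂(Measure.infinitePi fun _ : ι' => H) ∂(Measure.pi fun _ : ι => H) := by
  have hm : Measurable fun p : (ι → S) × (ι' → S) => (Sum.elim p.1 p.2 : ι ⊕ ι' → S) := by
    refine measurable_pi_lambda _ fun i => ?_
    cases i <;> simp only [Sum.elim_inl, Sum.elim_inr] <;> fun_prop
  have hG' : Measurable fun r : ι ⊕ ι' → S =>
      G (fun i => r (.inl i)) (fun j => r (.inr j)) :=
    hG.comp (f := fun r : ι ⊕ ι' → S => (fun i => r (.inl i), fun j => r (.inr j)))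
      (by fun_prop)
  have h1 := lintegral_map (μ := Measure.infinitePi fun _ : ℕ => H) hG'
    (g := fun s i => s (Sum.elim a b i)) (by fun_prop)
  rw [infinitePi_map_comp H hab, ← pi_prod_infinitePi_map_sumElim H, lintegral_map hG' hm,
    lintegral_prod _ (by exact hG.aemeasurable)] at h1
  exact h1.symm

theorem pi_withDensity {ι : Type*} [Fintype ι] (H : Measure S) [IsProbabilityMeasure H]
    {d : ι → S → ℝ≥0∞} (hd : ∀ i, Measurable (d i))
    [∀ i, SigmaFinite (H.withDensity (d i))] :
    (Measure.pi fun i => H.withDensity (d i)) =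
      (Measure.pi fun _ => H).withDensity fun s => ∏ i, d i (s i) := by
  refine Measure.pi_eq fun t ht => ?_
  -- On a box, the integrand is a product of functions of separate coordinates, so independence
  -- turns its integral into a product.
  have hi : iIndepFun (fun i (s : ι → S) => (t i).indicator (d i) (s i))
      (Measure.pi fun _ => H) :=
    iIndepFun_pi (X := fun i => (t i).indicator (d i))
      fun i => ((hd i).indicator (ht i)).aemeasurable
  have h := lintegral_prod_eq_prod_lintegral_of_indepFun Finset.univ _ hi
    fun i => ((hd i).indicator (ht i)).comp (measurable_pi_apply i)
  rw [withDensity_apply _ (MeasurableSet.univ_pi ht), ← lintegral_indicator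
    (MeasurableSet.univ_pi ht)]
  refine Eq.trans (lintegral_congr fun s => ?_) (h.trans (Finset.prod_congr rfl fun i _ => ?_))
  · by_cases hs : s ∈ Set.univ.pi t
    · rw [Set.indicator_of_mem hs]
      exact Finset.prod_congr rfl fun i _ => (Set.indicator_of_mem (hs i trivial) _).symm
    · rw [Set.indicator_of_notMem hs]
      simp only [Set.mem_pi, not_forall] at hs
      obtain ⟨i, _, hi⟩ := hs
      exact (Finset.prod_eq_zero (Finset.mem_univ i) (Set.indicator_of_notMem hi _)).symm
  · rw [withDensity_apply _ (ht i), ← lintegral_indicator (ht i)]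
    exact (measurePreserving_eval (fun _ : ι => H) i).lintegral_comp
      ((hd i).indicator (ht i))

end ProductMeasures

/-! ### Removing finitely many indices -/

/-- The increasing enumeration of the complement of the range of `a`. -/
noncomputable def complEnum {k : ℕ} (a : Fin k ↪ ℕ) : ℕ → ℕ := Nat.nth fun j => j ∉ Set.range a

theorem infinite_compl_range {k : ℕ} (a : Fin k ↪ ℕ) :
    (Set.ofPred fun j => j ∉ Set.range a).Infinite :=
  (Set.finite_range a).infinite_compl

theorem sumElim_complEnum_injective {k : ℕ} (a : Fin k ↪ ℕ) :
    Function.Injective (Sum.elim a (complEnum a)) := by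
  refine Function.Injective.sumElim a.injective
    (Nat.nth_injective (infinite_compl_range a)) fun i j h => ?_
  exact Nat.nth_mem_of_infinite (infinite_compl_range a) j ⟨i, h⟩

/-- Since all `k` removed indices lie below `m`, exactly `m - k` complementary indices do, and the
increasing enumeration lists them first. -/
theorem image_complEnum {k m : ℕ} (a : Fin k ↪ ℕ) (ha : ∀ i, a i < m) :
    (Finset.range (m - k)).image (complEnum a) = Finset.range m \ Finset.univ.map a := by
  classical
  have hinf := infinite_compl_range a
  have hc : Nat.count (fun j => j ∉ Set.range a) m = m - k := by
    rw [Nat.count_eq_card_filter_range]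
    have : (Finset.range m).filter (fun j => j ∉ Set.range a) =
        Finset.range m \ Finset.univ.map a := by
      ext j; simp
    rw [this, Finset.card_sdiff_of_subset, Finset.card_map, Finset.card_range,
      Finset.card_univ, Fintype.card_fin]
    intro j hj
    obtain ⟨i, _, rfl⟩ := Finset.mem_map.1 hj
    exact Finset.mem_range.2 (ha i)
  ext j
  simp only [Finset.mem_image, Finset.mem_range, Finset.mem_sdiff, Finset.mem_map,
    Finset.mem_univ, true_and, not_exists]
  constructor
  · rintro ⟨i, hi, rfl⟩
    refine ⟨Nat.nth_lt_of_lt_count (hc ▸ hi), fun h e => ?_⟩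
    exact Nat.nth_mem_of_infinite hinf i ⟨h, e⟩
  · rintro ⟨hj, hj'⟩
    have hp : j ∉ Set.range a := fun ⟨i, hi⟩ => hj' i hi
    refine ⟨Nat.count (fun j => j ∉ Set.range a) j, ?_, Nat.nth_count hp⟩
    rw [← hc]
    exact Nat.count_strict_mono hp hj

theorem sum_range_sdiff {k m : ℕ} {A : Type*} [AddCommMonoid A] (a : Fin k ↪ ℕ)
    (ha : ∀ i, a i < m) (g : ℕ → A) :
    ∑ j ∈ Finset.range m \ Finset.univ.map a, g j =
      ∑ j ∈ Finset.range (m - k), g (complEnum a j) := by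
  classical
  rw [← image_complEnum a ha, Finset.sum_image]
  exact fun _ _ _ _ h => Nat.nth_injective (infinite_compl_range a) h

theorem sum_range_split {k m : ℕ} {A : Type*} [AddCommMonoid A] (a : Fin k ↪ ℕ)
    (ha : ∀ i, a i < m) (g : ℕ → A) :
    ∑ j ∈ Finset.range m, g j =
      ∑ h, g (a h) + ∑ j ∈ Finset.range (m - k), g (complEnum a j) := by
  classical
  rw [← sum_range_sdiff a ha, ← Finset.sum_map Finset.univ a g, add_comm,
    Finset.sum_sdiff]
  intro j hj
  obtain ⟨i, _, rfl⟩ := Finset.mem_map.1 hj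
  exact Finset.mem_range.2 (ha i)

/-! ### Labels and allocations -/

theorem mem_activeLabels {n : ℕ} (J : Fin n → ℕ) (j : ℕ) :
    j ∈ activeLabels J ↔ ∃ i, J i = j := by
  simp [activeLabels, List.mem_ofFn]

theorem nodup_activeLabels {n : ℕ} (J : Fin n → ℕ) : (activeLabels J).Nodup :=
  List.nodup_reverse.2 (List.nodup_dedup _)

theorem dedup_map_of_injOn {α β : Type*} [DecidableEq α] [DecidableEq β] {g : α → β}
    (l : List α) (hg : ∀ x ∈ l, ∀ y ∈ l, g x = g y → x = y) :
    (l.map g).dedup = l.dedup.map g := by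
  induction l with
  | nil => simp
  | cons x l ih =>
    have ih' := ih fun x hx y hy => hg x (List.mem_cons_of_mem _ hx) y (List.mem_cons_of_mem _ hy)
    by_cases hx : x ∈ l
    · rw [List.map_cons, List.dedup_cons_of_mem hx,
        List.dedup_cons_of_mem (List.mem_map_of_mem hx), ih']
    · have hx' : g x ∉ l.map g := fun h => by
        obtain ⟨y, hy, e⟩ := List.mem_map.1 h
        exact hx (hg y (List.mem_cons_of_mem _ hy) x List.mem_cons_self e ▸ hy)
      rw [List.map_cons, List.dedup_cons_of_notMem hx, List.dedup_cons_of_notMem hx', ih',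
        List.map_cons]

/-- Relabelling injectively on the labels that occur preserves the order of appearance: reversal and
deduplication both commute with such a map. -/
theorem activeLabels_comp {n : ℕ} (C : Fin n → ℕ) {g : ℕ → ℕ}
    (hg : ∀ i i', g (C i) = g (C i') → C i = C i') :
    activeLabels (fun i => g (C i)) = (activeLabels C).map g := by
  have e : List.ofFn (fun i => g (C i)) = (List.ofFn C).map g := by
    rw [List.map_ofFn]; rfl
  rw [activeLabels, activeLabels, e, ← List.map_reverse, dedup_map_of_injOn, List.map_reverse]
  intro x hx y hy
  simp only [List.mem_reverse, List.mem_ofFn] at hx hy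
  obtain ⟨i, rfl⟩ := hx
  obtain ⟨i', rfl⟩ := hy
  exact hg i i'

/-- The allocations of `n` observations to `k` active components, which are numbered in order of
appearance. -/
abbrev Allocation (n k : ℕ) : Type := {C : Fin n → ℕ // activeLabels C = List.range k}

namespace Allocation

variable {n k : ℕ}

theorem exists_eq (C : Allocation n k) (h : Fin k) : ∃ i, C.1 i = h :=
  (mem_activeLabels C.1 h).1 (by rw [C.2]; exact List.mem_range.2 h.2)

theorem lt (C : Allocation n k) (i : Fin n) : C.1 i < k :=
  List.mem_range.1 ((congrArg (fun l => C.1 i ∈ l) C.2).mp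
    ((mem_activeLabels C.1 _).2 ⟨i, rfl⟩))

/-- The labels of the observations, if the `h`-th active component has the label `a h`. -/
def labels (C : Allocation n k) (a : Fin k ↪ ℕ) : Fin n → ℕ := fun i => a ⟨C.1 i, C.lt i⟩

theorem activeLabels_labels (C : Allocation n k) (a : Fin k ↪ ℕ) :
    activeLabels (C.labels a) = List.ofFn a := by
  have e : C.labels a = fun i => (fun h => if h' : h < k then a ⟨h, h'⟩ else 0) (C.1 i) := by
    funext i
    simp [labels, C.lt i]
  rw [e, activeLabels_comp (g := fun h => if h' : h < k then a ⟨h, h'⟩ else 0), C.2]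
  · apply List.ext_getElem <;> simp
    intro i h1
    rw [dif_pos h1]
  · intro i i' h
    simpa [C.lt] using h

theorem numActive_labels (C : Allocation n k) (a : Fin k ↪ ℕ) : numActive (C.labels a) = k := by
  rw [numActive, activeLabels_labels, List.length_ofFn]

theorem getD_labels (C : Allocation n k) (a : Fin k ↪ ℕ) (h : Fin k) :
    (activeLabels (C.labels a)).getD h 0 = a h := by
  rw [activeLabels_labels]
  simp

theorem alloc_labels (C : Allocation n k) (a : Fin k ↪ ℕ) : alloc (C.labels a) = C.1 := by
  funext i
  have hn := nodup_activeLabels (C.labels a)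
  have hl : C.1 i < (activeLabels (C.labels a)).length := by
    rw [activeLabels_labels, List.length_ofFn]; exact C.lt i
  have := hn.idxOf_getElem (C.1 i) hl
  rw [alloc, ← this]
  congr 1
  simp only [activeLabels_labels, List.getElem_ofFn]
  rfl

/-- The allocation relabels `J` by positions in the list of active labels; this is injective on that
list and sends the list to its own positions. -/
theorem alloc_mem (J : Fin n → ℕ) : activeLabels (alloc J) = List.range (numActive J) := by
  have h : activeLabels (alloc J) = (activeLabels J).map (fun j => (activeLabels J).idxOf j) := by
    refine activeLabels_comp J (g := fun j => (activeLabels J).idxOf j) fun i i' h => ?_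
    exact (List.idxOf_inj ((mem_activeLabels J _).2 ⟨i, rfl⟩)).1 h
  rw [h]
  apply List.ext_getElem
  · simp [numActive]
  · intro i h1 h2
    simp only [List.getElem_map, List.getElem_range]
    exact (nodup_activeLabels J).idxOf_getElem _ _

/-- The labels of the observations amount to the allocations and the labels of the active
components. -/
noncomputable def labelsEquiv (n k : ℕ) :
    Allocation n k × (Fin k ↪ ℕ) ≃ {J : Fin n → ℕ // numActive J = k} where
  toFun p := ⟨p.1.labels p.2, p.1.numActive_labels p.2⟩
  invFun J := ⟨⟨alloc J.1, by rw [alloc_mem, J.2]⟩,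
    ⟨fun h => (activeLabels J.1)[h.1]'(lt_of_lt_of_eq h.2 J.2.symm), fun h h' e => Fin.ext
      ((nodup_activeLabels J.1).getElem_inj_iff.1 e)⟩⟩
  left_inv p := by
    refine Prod.ext (Subtype.ext (p.1.alloc_labels p.2)) ?_
    ext h
    simp [p.1.activeLabels_labels p.2]
  right_inv J := by
    refine Subtype.ext (funext fun i => ?_)
    exact List.getElem_idxOf _

theorem prod_labels {A : Type*} [CommMonoid A] (C : Allocation n k) (a : Fin k ↪ ℕ)
    (g : ℕ → A) : ∏ i, g (C.labels a i) = ∏ h : Fin k, g (a h) ^ clusterSize C.1 h := by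
  classical
  rw [← Finset.prod_fiberwise_of_maps_to (s := Finset.univ) (t := Finset.univ)
    (g := fun i => (⟨C.1 i, C.lt i⟩ : Fin k)) fun _ _ => Finset.mem_univ _]
  refine Finset.prod_congr rfl fun h _ => ?_
  rw [clusterSize, ← Finset.prod_const]
  refine Finset.prod_congr ?_ fun i hi => ?_
  · ext i; simp [Fin.ext_iff]
  · simp only [Finset.mem_filter] at hi
    exact congrArg (fun h => g (a h)) (Fin.ext hi.2)

theorem pos (C : Allocation n k) (hn : 1 ≤ n) : 0 < k := (Nat.zero_le _).trans_lt (C.lt ⟨0, hn⟩)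

end Allocation

variable {E S 𝕏 𝕎 Z : Type*} [MeasurableSpace E] [MeasurableSpace S] [MeasurableSpace 𝕏]
  [MeasurableSpace 𝕎] [MeasurableSpace Z]

/-! ### Counting measures -/

theorem measurable_sum_smul_dirac {α ι : Type*} [MeasurableSpace α] (t : Finset ι)
    {r : ι → α → ℝ≥0∞} {y : ι → α → E} (hr : ∀ i ∈ t, Measurable (r i))
    (hy : ∀ i ∈ t, Measurable (y i)) :
    Measurable fun p => ∑ i ∈ t, r i p • (Measure.dirac (y i p) : Measure E) := by
  refine Finset.measurable_sum _ fun i hi => Measure.measurable_of_measurable_coe _ fun s hs => ?_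
  simp only [Measure.smul_apply, smul_eq_mul]
  exact (hr i hi).mul ((Measure.measurable_coe hs).comp (Measure.measurable_dirac.comp (hy i hi)))

theorem measurable_sum_dirac {α ι : Type*} [MeasurableSpace α] (t : Finset ι)
    {y : ι → α → E} (hy : ∀ i ∈ t, Measurable (y i)) :
    Measurable fun p => ∑ i ∈ t, (Measure.dirac (y i p) : Measure E) := by
  simpa using measurable_sum_smul_dirac t (r := fun _ _ => 1)
    (fun _ _ => measurable_const) hy

theorem measurable_counting : Measurable (counting : Config E → Measure E) :=
  measurable_of_index (g := fun m (c : Config E) =>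
    ∑ j ∈ Finset.range m, (Measure.dirac (c.2 j) : Measure E)) measurable_fst
    fun _ => measurable_sum_dirac _ fun _ _ => by fun_prop

open Classical in
theorem counting_apply (c : Config E) {s : Set E} (hs : MeasurableSet s) :
    counting c s =
      (Finset.univ.filter fun j : {j // j ∈ Finset.range c.1} => c.2 j ∈ s).card := by
  rw [counting, Measure.finsetSum_apply, ← Finset.sum_coe_sort, Finset.card_filter]
  push_cast
  refine Finset.sum_congr rfl fun j _ => ?_
  rw [Measure.dirac_apply' _ hs]
  by_cases h : c.2 j ∈ s <;> simp [h]

instance (c : Config E) : IsFiniteMeasure (counting c) :=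
  ⟨by rw [counting_apply c MeasurableSet.univ]; exact ENNReal.natCast_lt_top _⟩

/-- Evaluating at singletons shows that each point has the same multiplicity in both configurations;
gluing bijections of the fibres gives the permutation. -/
theorem exists_perm_of_counting_eq [MeasurableSingletonClass E] {c c' : Config E}
    (h : counting c = counting c') :
    c.1 = c'.1 ∧ ∃ σ : Equiv.Perm ℕ, (∀ j, σ j < c.1 ↔ j < c.1) ∧
      ∀ j < c.1, c'.2 (σ j) = c.2 j := by
  classical
  obtain ⟨m, x⟩ := c
  obtain ⟨m', x'⟩ := c'
  have hm : m = m' := by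
    have := congrArg (fun ν => ν Set.univ) h
    simpa [counting_apply _ MeasurableSet.univ] using this
  subst hm
  refine ⟨rfl, ?_⟩
  have hcard (y : E) : Fintype.card {j : {j // j ∈ Finset.range m} // x j = y} =
      Fintype.card {j : {j // j ∈ Finset.range m} // x' j = y} := by
    have := congrArg (fun ν => ν {y}) h
    simp only [counting_apply _ (measurableSet_singleton y)] at this
    rw [Fintype.card_subtype, Fintype.card_subtype]
    exact_mod_cast this
  let σ : Equiv.Perm {j // j ∈ Finset.range m} :=
    (Equiv.sigmaFiberEquiv fun j : {j // j ∈ Finset.range m} => x j).symm.trans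
      ((Equiv.sigmaCongrRight fun y => Fintype.equivOfCardEq (hcard y)).trans
        (Equiv.sigmaFiberEquiv fun j : {j // j ∈ Finset.range m} => x' j))
  have hσ (j : {j // j ∈ Finset.range m}) : x' (σ j) = x j :=
    (Fintype.equivOfCardEq (hcard (x j)) ⟨j, rfl⟩).2
  refine ⟨Equiv.Perm.ofSubtype σ, fun j => ?_, ?_⟩
  · simpa using Equiv.Perm.ofSubtype_apply_mem_iff_mem σ j
  intro j hj
  rw [Equiv.Perm.ofSubtype_apply_of_mem σ (Finset.mem_range.2 hj)]
  exact hσ ⟨j, Finset.mem_range.2 hj⟩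

theorem injOn_of_counting_eq [MeasurableSingletonClass E] {c c' : Config E}
    (h : counting c = counting c') (hc : Set.InjOn c.2 (Set.Iio c.1)) :
    Set.InjOn c'.2 (Set.Iio c'.1) := by
  obtain ⟨hm, σ, hσ, hx⟩ := exists_perm_of_counting_eq h.symm
  intro i hi j hj hij
  refine σ.injective (hc ?_ ?_ ?_)
  · rw [← hm]; exact (hσ i).2 hi
  · rw [← hm]; exact (hσ j).2 hj
  · rw [hx i hi, hx j hj, hij]

/-- Countably many evaluations, on a generating π-system together with the total mass, determine a
finite measure. This provides the countably separated target needed for the separation argument. -/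
theorem exists_measurable_injOn_isFiniteMeasure [StandardBorelSpace E] :
    ∃ q : Measure E → Option ℚ → ℝ≥0∞, Measurable q ∧
      ∀ μ ν : Measure E, IsFiniteMeasure μ → q μ = q ν → μ = ν := by
  obtain ⟨g, hg⟩ := exists_measurableEmbedding_real E
  refine ⟨fun μ o => o.elim (μ Set.univ) fun r => μ (g ⁻¹' Set.Iio (r : ℝ)), ?_, ?_⟩
  · refine measurable_pi_lambda _ fun o => ?_
    cases o
    · exact Measure.measurable_coe MeasurableSet.univ
    · exact Measure.measurable_coe (hg.measurable measurableSet_Iio)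
  · intro μ ν _ h
    refine ext_of_generate_finite
      {s | ∃ t ∈ ⋃ r : ℚ, {Set.Iio (r : ℝ)}, g ⁻¹' t = s} ?_
      (Real.isPiSystem_Iio_rat.comap g) ?_ (congrFun h none)
    · rw [← hg.comap_eq, Real.borelSpace.measurable_eq, Real.borel_eq_generateFrom_Iio_rat,
        MeasurableSpace.comap_generateFrom]
      rfl
    · rintro _ ⟨t, ht, rfl⟩
      obtain ⟨r, hr⟩ := Set.mem_iUnion.1 ht
      rw [Set.mem_singleton_iff.1 hr]
      exact congrFun h (some r)

theorem measurableSet_comap_counting {α : Type*} [MeasurableSpace α] [StandardBorelSpace α]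
    [StandardBorelSpace E] {s : Set (α × Config E)} (hs : MeasurableSet s)
    (hinv : ∀ x c c', counting c = counting c' → (x, c) ∈ s → (x, c') ∈ s) :
    MeasurableSet[MeasurableSpace.comap (Prod.map id counting) inferInstance] s := by
  obtain ⟨q, hq, hq'⟩ := exists_measurable_injOn_isFiniteMeasure (E := E)
  have hf : Measurable fun p : α × Config E => (p.1, q (counting p.2)) :=
    measurable_fst.prodMk (hq.comp (measurable_counting.comp measurable_snd))
  have e : (fun p : α × Config E => (p.1, q (counting p.2))) ⁻¹'
      ((fun p : α × Config E => (p.1, q (counting p.2))) '' s) = s := by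
    refine Set.Subset.antisymm ?_ (Set.subset_preimage_image _ _)
    rintro ⟨x, c⟩ ⟨⟨x', c'⟩, h', h⟩
    obtain ⟨rfl, h⟩ := Prod.mk.inj h
    exact hinv _ c' c (hq' _ _ inferInstance h) h'
  -- By Lusin separation, a saturated measurable subset of a standard Borel space has measurable
  -- image inside the range of the map.
  have h := (hf.measurableSet_preimage_iff_preimage_val).1 (by rw [e]; exact hs)
  obtain ⟨t, ht, hts⟩ := h
  refine ⟨(Prod.map id q) ⁻¹' t, (measurable_id.prodMap hq) ht, ?_⟩
  ext ⟨x, c⟩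
  have := Set.ext_iff.1 hts ⟨_, Set.mem_range_self (x, c)⟩
  conv_rhs => rw [← e]
  exact this

/-- Rectangles and σ-finiteness of the first marginal identify the two images under `counting`; an
invariant integrand is measurable for the pulled-back σ-algebra and sees only these images. -/
theorem lintegral_eq_of_counting {α : Type*} [MeasurableSpace α] [StandardBorelSpace α]
    [StandardBorelSpace E] {ρ ρ' : Measure (α × Config E)} [SigmaFinite ρ.fst]
    (h : ∀ (B : Set α) (L : Set (Measure E)), MeasurableSet B → MeasurableSet L →
      ρ (B ×ˢ (counting ⁻¹' L)) = ρ' (B ×ˢ (counting ⁻¹' L)))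
    {Ψ : α × Config E → ℝ≥0∞} (hΨ : Measurable Ψ)
    (hinv : ∀ x c c', counting c = counting c' → Ψ (x, c) = Ψ (x, c')) :
    ∫⁻ p, Ψ p ∂ρ = ∫⁻ p, Ψ p ∂ρ' := by
  have hg : Measurable (Prod.map id counting : α × Config E → α × Measure E) :=
    measurable_id.prodMap measurable_counting
  have hmap : ρ.map (Prod.map id counting) = ρ'.map (Prod.map id counting) := by
    refine Measure.ext_of_generateFrom_of_iUnion
      (Set.image2 (· ×ˢ ·) {s : Set α | MeasurableSet s} {t : Set (Measure E) | MeasurableSet t})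
      (fun i => spanningSets ρ.fst i ×ˢ Set.univ) generateFrom_prod.symm isPiSystem_prod ?_ ?_ ?_ ?_
    · rw [← Set.iUnion_prod_const, iUnion_spanningSets, Set.univ_prod_univ]
    · exact fun i => ⟨_, measurableSet_spanningSets _ i, Set.univ,
        by simp, rfl⟩
    · intro i
      rw [Measure.map_apply hg ((measurableSet_spanningSets _ i).prod MeasurableSet.univ)]
      have := measure_spanningSets_lt_top ρ.fst i
      rw [Measure.fst_apply (measurableSet_spanningSets _ i)] at this
      refine ne_of_lt (lt_of_le_of_lt (measure_mono ?_) this)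
      exact fun p hp => hp.1
    · rintro _ ⟨B, hB, L, hL, rfl⟩
      rw [Measure.map_apply hg (hB.prod hL), Measure.map_apply hg (hB.prod hL)]
      exact h B L hB hL
  have htrim : ρ.trim hg.comap_le = ρ'.trim hg.comap_le := by
    refine @Measure.ext _ (_) _ _ fun s hs => ?_
    rw [trim_measurableSet_eq _ hs, trim_measurableSet_eq _ hs]
    obtain ⟨t, ht, rfl⟩ := hs
    rw [← Measure.map_apply hg ht, hmap, Measure.map_apply hg ht]
  have hΨ' : Measurable[MeasurableSpace.comap (Prod.map id counting) inferInstance] Ψ :=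
    fun t ht => measurableSet_comap_counting (hΨ ht) fun x c c' hc hx => by
      simpa [← hinv x c c' hc] using hx
  rw [← lintegral_trim hg.comap_le hΨ', htrim, lintegral_trim hg.comap_le hΨ']

/-! ### Campbell measures -/

/-- The configuration of the points whose indices are not in the range of `a`. -/
noncomputable def remove {k : ℕ} (a : Fin k ↪ ℕ) (c : Config E) : Config E :=
  (c.1 - k, fun j => c.2 (complEnum a j))

theorem measurable_remove {k : ℕ} (a : Fin k ↪ ℕ) :
    Measurable (remove a : Config E → Config E) := by
  unfold remove
  fun_prop

theorem measurableSet_forall_lt {k : ℕ} (a : Fin k → ℕ) :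
    MeasurableSet {c : Config E | ∀ i, a i < c.1} :=
  MeasurableSet.preimage (t := {m : ℕ | ∀ i, a i < m}) (MeasurableSet.of_discrete) measurable_fst

/-- The reduced Campbell measure, with the remaining points enumerated in their order. -/
noncomputable def enumCampbell (Φ : Measure (Config E)) (k : ℕ) :
    Measure ((Fin k → E) × Config E) :=
  Measure.sum fun a : Fin k ↪ ℕ =>
    (Φ.restrict {c | ∀ i, a i < c.1}).map fun c => (fun i => c.2 (a i), remove a c)

theorem fst_enumCampbell (Φ : Measure (Config E)) (k : ℕ) :
    (enumCampbell Φ k).fst = factorialMoment Φ k := by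
  rw [Measure.fst, enumCampbell, Measure.map_sum measurable_fst.aemeasurable, factorialMoment]
  congr 1
  funext a
  have := measurable_remove (E := E) a
  rw [Measure.map_map measurable_fst (by fun_prop)]
  rfl

theorem enumCampbell_map (Φ : Measure (Config E)) (k : ℕ) :
    (enumCampbell Φ k).map (Prod.map id counting) = reducedCampbell Φ k := by
  have hg : Measurable (Prod.map id counting : (Fin k → E) × Config E → (Fin k → E) × Measure E) :=
    measurable_id.prodMap measurable_counting
  rw [enumCampbell, Measure.map_sum hg.aemeasurable, reducedCampbell]
  congr 1
  funext a
  have := measurable_remove (E := E) a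
  rw [Measure.map_map hg (by fun_prop)]
  refine Measure.map_congr ?_
  filter_upwards [ae_restrict_mem (measurableSet_forall_lt a)] with c hc
  refine Prod.ext rfl ?_
  exact (sum_range_sdiff a hc fun j => Measure.dirac (c.2 j)).symm

theorem enumCampbell_prod (Φ : Measure (Config E)) (k : ℕ) {B : Set (Fin k → E)}
    {L : Set (Measure E)} (hB : MeasurableSet B) (hL : MeasurableSet L) :
    enumCampbell Φ k (B ×ˢ (counting ⁻¹' L)) = reducedCampbell Φ k (B ×ˢ L) := by
  rw [← enumCampbell_map, Measure.map_apply (measurable_id.prodMap measurable_counting)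
    (hB.prod hL)]
  rfl

/-- A strictly positive integrable weight in the first variable reduces to a finite measure. Such a
weight cancels from the disintegration, so the conditional kernel serves the original measure too.
-/
theorem exists_isMarkovKernel_compProd_eq {α Ω : Type*} [MeasurableSpace α] [MeasurableSpace Ω]
    [StandardBorelSpace Ω] [Nonempty Ω] (ρ : Measure (α × Ω)) [SigmaFinite ρ.fst] :
    ∃ P : Kernel α Ω, IsMarkovKernel P ∧ ∀ B D, MeasurableSet B → MeasurableSet D →
      ρ (B ×ˢ D) = ∫⁻ x in B, P x D ∂ρ.fst := by
  obtain ⟨g, hg, hgm, hgi⟩ := exists_pos_lintegral_lt_of_sigmaFinite ρ.fst one_ne_zero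
  have hG : Measurable fun p : α × Ω => (g p.1 : ℝ≥0∞) := by fun_prop
  have hGi : Measurable fun p : α × Ω => (g p.1 : ℝ≥0∞)⁻¹ := by fun_prop
  have hlt : ∫⁻ p, (g p.1 : ℝ≥0∞) ∂ρ < ∞ := by
    refine lt_of_eq_of_lt ?_ (hgi.trans ENNReal.one_lt_top)
    rw [Measure.fst, lintegral_map (by fun_prop) measurable_fst]
  let ρ' := ρ.withDensity fun p => (g p.1 : ℝ≥0∞)
  have : IsFiniteMeasure ρ' := isFiniteMeasure_withDensity hlt.ne
  refine ⟨ρ'.condKernel, inferInstance, fun B D hB hD => ?_⟩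
  have hback : ρ = ρ'.withDensity fun p => (g p.1 : ℝ≥0∞)⁻¹ := by
    rw [← withDensity_mul _ hG hGi]
    have : (fun p : α × Ω => (g p.1 : ℝ≥0∞)) * (fun p => (g p.1 : ℝ≥0∞)⁻¹) = 1 := by
      funext p
      exact ENNReal.mul_inv_cancel (ENNReal.coe_ne_zero.2 (hg p.1).ne') ENNReal.coe_ne_top
    rw [this, withDensity_one]
  have hfst : ρ'.fst = ρ.fst.withDensity fun x => (g x : ℝ≥0∞) := by
    ext s hs
    rw [Measure.fst_apply hs, withDensity_apply _ (measurable_fst hs), withDensity_apply _ hs,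
      Measure.fst, setLIntegral_map hs (by fun_prop) measurable_fst]
  conv_lhs => rw [hback]
  have hd := Measure.setLIntegral_compProd (μ := ρ'.fst) (κ := ρ'.condKernel) hGi hB hD
  rw [ρ'.disintegrate ρ'.condKernel] at hd
  rw [withDensity_apply _ (hB.prod hD), hd]
  simp only [setLIntegral_const]
  rw [hfst, ← lintegral_indicator hB, ← lintegral_indicator hB,
    lintegral_withDensity_eq_lintegral_mul _ (by fun_prop)]
  · refine lintegral_congr fun x => ?_
    by_cases hx : x ∈ B
    · simp only [Pi.mul_apply, Set.indicator_of_mem hx]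
      rw [← mul_assoc, ENNReal.mul_inv_cancel (by exact_mod_cast (hg x).ne') ENNReal.coe_ne_top,
        one_mul]
    · simp [Set.indicator_of_notMem hx]
  · exact Measurable.indicator (Measurable.mul (by fun_prop)
      (Kernel.measurable_coe _ hD)) hB

theorem exists_isReducedPalm [StandardBorelSpace E] [Nonempty E] (Φ : Measure (Config E)) (k : ℕ)
    [hM : SigmaFinite (factorialMoment Φ k)] :
    ∃ P : Kernel (Fin k → E) (Config E), IsReducedPalm Φ k P := by
  have : SigmaFinite (enumCampbell Φ k).fst := by rw [fst_enumCampbell]; exact hM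
  obtain ⟨P, hP, h⟩ := exists_isMarkovKernel_compProd_eq (enumCampbell Φ k)
  refine ⟨P, hP, fun B L hB hL => ?_⟩
  rw [← enumCampbell_prod _ _ hB hL, h B _ hB (measurable_counting hL), fst_enumCampbell]
  rfl

/-! ### Campbell's formula for an arbitrary Palm version, and simplicity -/

namespace IsReducedPalm

variable [StandardBorelSpace E] {Φ : Measure (Config E)} {k : ℕ}
  {P : Kernel (Fin k → E) (Config E)}

/-- The enumeration chosen by `P` need not agree with that of `remove`; the invariance of `Ψ` makes
this irrelevant. -/
theorem lintegral_enumCampbell (hP : IsReducedPalm Φ k P) [hM : SigmaFinite (factorialMoment Φ k)]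
    {Ψ : (Fin k → E) × Config E → ℝ≥0∞} (hΨ : Measurable Ψ)
    (hinv : ∀ x c c', counting c = counting c' → Ψ (x, c) = Ψ (x, c')) :
    ∫⁻ p, Ψ p ∂(enumCampbell Φ k) = ∫⁻ x, ∫⁻ c, Ψ (x, c) ∂(P x) ∂(factorialMoment Φ k) := by
  have := hP.markov
  have : SigmaFinite (enumCampbell Φ k).fst := by rw [fst_enumCampbell]; exact hM
  rw [← Measure.lintegral_compProd hΨ]
  refine lintegral_eq_of_counting (fun B L hB hL => ?_) hΨ hinv
  rw [enumCampbell_prod _ _ hB hL, hP.campbell B L hB hL,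
    Measure.compProd_apply_prod hB (measurable_counting hL)]
  rfl

theorem measurableSet_injOn : MeasurableSet {c : Config E | Set.InjOn c.2 (Set.Iio c.1)} := by
  have e : {c : Config E | Set.InjOn c.2 (Set.Iio c.1)} =
      ⋂ i : ℕ, ⋂ j : ℕ, {c | i < c.1 → j < c.1 → c.2 i = c.2 j → i = j} := by
    ext c
    simp only [Set.mem_ofPred_eq, Set.mem_iInter]
    exact ⟨fun h i j hi hj => h hi hj, fun h i hi j hj => h i j hi hj⟩
  rw [e]
  refine MeasurableSet.iInter fun i => MeasurableSet.iInter fun j => ?_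
  have h1 (i : ℕ) : MeasurableSet {c : Config E | i < c.1} :=
    measurableSet_lt measurable_const measurable_fst
  have h2 : MeasurableSet {c : Config E | c.2 i = c.2 j} :=
    measurableSet_eq_fun (by fun_prop) (by fun_prop)
  exact (h1 i).imp ((h1 j).imp (h2.imp (MeasurableSet.const _)))

/-- Having a repeated point is invariant under re-enumeration, and it cannot arise by removing
points from a simple configuration, so Campbell's formula assigns it mass zero. -/
theorem ae_isSimple (hP : IsReducedPalm Φ k P) [SigmaFinite (factorialMoment Φ k)]
    (hΦ : IsSimple Φ) : ∀ᵐ x ∂(factorialMoment Φ k), IsSimple (P x) := by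
  have hs := (measurableSet_injOn (E := E)).compl
  have h := hP.lintegral_enumCampbell
    (Ψ := fun p => Set.indicator {c : Config E | Set.InjOn c.2 (Set.Iio c.1)}ᶜ 1 p.2)
    ((measurable_one.indicator hs).comp measurable_snd) fun x c c' hc => by
      have : Set.InjOn c.2 (Set.Iio c.1) ↔ Set.InjOn c'.2 (Set.Iio c'.1) :=
        ⟨injOn_of_counting_eq hc, injOn_of_counting_eq hc.symm⟩
      by_cases h : Set.InjOn c.2 (Set.Iio c.1)
      · rw [Set.indicator_of_notMem (by simpa using h),
          Set.indicator_of_notMem (by simpa using this.1 h)]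
      · rw [Set.indicator_of_mem (by simpa using h),
          Set.indicator_of_mem (by simpa using fun h' => h (this.2 h'))]
        rfl
  have h0 : ∫⁻ p, Set.indicator {c : Config E | Set.InjOn c.2 (Set.Iio c.1)}ᶜ
      (1 : Config E → ℝ≥0∞) p.2 ∂(enumCampbell Φ k) = 0 := by
    rw [enumCampbell, lintegral_sum_measure, ENNReal.tsum_eq_zero]
    intro a
    have := measurable_remove (E := E) a
    rw [lintegral_map (by exact (measurable_one.indicator hs).comp measurable_snd) (by fun_prop)]
    refine lintegral_eq_zero_of_ae_eq_zero ?_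
    filter_upwards [ae_restrict_of_ae hΦ, ae_restrict_mem (measurableSet_forall_lt a)] with c hc ha
    refine Set.indicator_of_notMem ?_ _
    simp only [Set.mem_compl_iff, not_not, Set.mem_ofPred_eq]
    intro i hi j hj hij
    have hlt {i : ℕ} (hi : i < c.1 - k) : complEnum a i < c.1 :=
      Finset.mem_range.1 (Finset.mem_sdiff.1 (by
        rw [← image_complEnum a ha]
        exact Finset.mem_image_of_mem _ (Finset.mem_range.2 hi))).1
    exact Nat.nth_injective (infinite_compl_range a) (hc (hlt hi) (hlt hj) hij)
  simp only [lintegral_indicator_one hs] at h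
  rw [h0, eq_comm, lintegral_eq_zero_iff (P.measurable_coe hs)] at h
  filter_upwards [h] with x hx
  exact hx

end IsReducedPalm

/-! ### Marked configurations and random measures -/

theorem measurable_attach :
    Measurable fun p : Config E × (ℕ → S) => ((p.1.1, fun j => (p.1.2 j, p.2 j)) : Config (E × S)) := by
  fun_prop

theorem lintegral_mark (Φ : Measure (Config E)) [SFinite Φ] (H : Measure S)
    [IsProbabilityMeasure H] {G : Config (E × S) → ℝ≥0∞} (hG : Measurable G) :
    ∫⁻ c, G c ∂(mark Φ H) =
      ∫⁻ c, ∫⁻ s, G (c.1, fun j => (c.2 j, s j)) ∂(Measure.infinitePi fun _ : ℕ => H) ∂Φ := by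
  rw [mark, lintegral_map hG measurable_attach, lintegral_prod _
    (by exact (hG.comp measurable_attach).aemeasurable)]

instance (Φ : Measure (Config E)) [IsProbabilityMeasure Φ] (H : Measure S)
    [IsProbabilityMeasure H] : IsProbabilityMeasure (mark Φ H) :=
  Measure.isProbabilityMeasure_map measurable_attach.aemeasurable

theorem measurable_atomic : Measurable (atomic : Config (𝕏 × ℝ≥0) → Measure 𝕏) :=
  measurable_of_index (g := fun m (c : Config (𝕏 × ℝ≥0)) =>
    ∑ j ∈ Finset.range m, ((c.2 j).2 : ℝ≥0∞) • (Measure.dirac (c.2 j).1 : Measure 𝕏))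
    measurable_fst fun _ => measurable_sum_smul_dirac _ (fun _ _ => by fun_prop)
      fun _ _ => by fun_prop

theorem measurable_markedAtomic :
    Measurable (markedAtomic : Config ((𝕏 × ℝ≥0) × 𝕎) → Measure (𝕏 × 𝕎)) :=
  measurable_of_index (g := fun m (c : Config ((𝕏 × ℝ≥0) × 𝕎)) =>
    ∑ j ∈ Finset.range m,
      ((c.2 j).1.2 : ℝ≥0∞) • (Measure.dirac ((c.2 j).1.1, (c.2 j).2) : Measure (𝕏 × 𝕎)))
    measurable_fst fun _ => measurable_sum_smul_dirac _ (fun _ _ => by fun_prop)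
      fun _ _ => by fun_prop

theorem integral_atomic (c : Config (𝕏 × ℝ≥0)) {f : 𝕏 → ℝ} (hf : Measurable f) :
    ∫ x, f x ∂(atomic c) = ∑ j ∈ Finset.range c.1, ((c.2 j).2 : ℝ) * f (c.2 j).1 := by
  rw [atomic, integral_finsetSum_measure]
  · refine Finset.sum_congr rfl fun j _ => ?_
    rw [integral_smul_measure, integral_dirac' _ _ hf.stronglyMeasurable]
    simp
  · intro j _
    exact (integrable_dirac' hf.stronglyMeasurable (by simp)).smul_measure ENNReal.coe_ne_top

theorem laplace_map_atomic (Q : Measure (Config (𝕏 × ℝ≥0))) {f : 𝕏 → ℝ} (hf : Measurable f)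
    (h0 : ∀ x, 0 ≤ f x) : laplace (Q.map atomic) f =
      ∫ c, Real.exp (-∑ j ∈ Finset.range c.1, ((c.2 j).2 : ℝ) * f (c.2 j).1) ∂Q := by
  -- Nonnegativity of `f` allows passing to the lower integral, which is measurable in the measure.
  have hm : Measurable fun μ : Measure 𝕏 => ∫ x, f x ∂μ := by
    simp_rw [fun μ : Measure 𝕏 => integral_eq_lintegral_of_nonneg_ae
      (Filter.Eventually.of_forall h0 : 0 ≤ᵐ[μ] f) hf.aestronglyMeasurable]
    exact (Measure.measurable_lintegral (by fun_prop)).ennreal_toReal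
  rw [laplace, integral_map measurable_atomic.aemeasurable
    (by exact (Real.measurable_exp.comp hm.neg).aestronglyMeasurable)]
  simp_rw [integral_atomic _ hf]

/-! ### The law of the non-active part -/

/-- The exponential tilting `exp (-u ∑ j, s j)`. -/
noncomputable def tilt (u : ℝ) (c : Config (𝕏 × ℝ≥0)) : ℝ≥0∞ :=
  ENNReal.ofReal (Real.exp (-∑ j ∈ Finset.range c.1, ((c.2 j).2 : ℝ) * u))

theorem measurable_tilt :
    Measurable fun p : ℝ × Config (𝕏 × ℝ≥0) => tilt p.1 p.2 := by
  unfold tilt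
  have : Measurable fun p : ℝ × Config (𝕏 × ℝ≥0) =>
      ∑ j ∈ Finset.range p.2.1, ((p.2.2 j).2 : ℝ) * p.1 :=
    measurable_of_index (g := fun m (p : ℝ × Config (𝕏 × ℝ≥0)) =>
      ∑ j ∈ Finset.range m, ((p.2.2 j).2 : ℝ) * p.1) (by fun_prop)
      fun _ => Finset.measurable_sum _ fun _ _ => by fun_prop
  fun_prop

theorem tilt_le_one {u : ℝ} (hu : 0 ≤ u) (c : Config (𝕏 × ℝ≥0)) : tilt u c ≤ 1 := by
  rw [tilt, ENNReal.ofReal_le_one, Real.exp_le_one_iff, neg_nonpos]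
  exact Finset.sum_nonneg fun j _ => mul_nonneg (NNReal.coe_nonneg _) hu

/-- The law of the configuration with points from `R` and i.i.d. jumps from `H`, tilted by
`exp (-u ∑ j, s j)`. -/
noncomputable def nonActive (R : Measure (Config 𝕏)) (H : Measure ℝ≥0) [IsProbabilityMeasure H]
    (u : ℝ) : Measure (Config (𝕏 × ℝ≥0)) :=
  (∫⁻ c, tilt u c ∂(mark R H))⁻¹ • (mark R H).withDensity (tilt u)

section nonActive

variable (R : Measure (Config 𝕏)) [IsProbabilityMeasure R] (H : Measure ℝ≥0)
  [IsProbabilityMeasure H] {u : ℝ}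

theorem measurable_tilt_right (u : ℝ) : Measurable (tilt u : Config (𝕏 × ℝ≥0) → ℝ≥0∞) :=
  measurable_tilt.comp (f := fun c : Config (𝕏 × ℝ≥0) => (u, c)) (by fun_prop)

theorem lintegral_tilt_ne_top (hu : 0 ≤ u) : ∫⁻ c, tilt u c ∂(mark R H) ≠ ∞ := by
  refine ne_of_lt (lt_of_le_of_lt (lintegral_mono fun c => tilt_le_one hu c) ?_)
  simp

theorem lintegral_tilt_ne_zero : ∫⁻ c, tilt u c ∂(mark R H) ≠ 0 := by
  rw [Ne, lintegral_eq_zero_iff (measurable_tilt_right u)]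
  intro h
  obtain ⟨c, hc⟩ := h.exists
  simp only [tilt, Pi.zero_apply, ENNReal.ofReal_eq_zero] at hc
  exact absurd hc (not_le.2 (Real.exp_pos _))

theorem isProbabilityMeasure_nonActive (hu : 0 ≤ u) :
    IsProbabilityMeasure (nonActive R H u) := by
  refine ⟨?_⟩
  rw [nonActive, Measure.smul_apply, withDensity_apply _ MeasurableSet.univ, setLIntegral_univ,
    smul_eq_mul, ENNReal.inv_mul_cancel (lintegral_tilt_ne_zero R H)
      (lintegral_tilt_ne_top R H hu)]

/-- Forgetting the jumps recovers `R`, and each single jump has law `H`, which does not charge zero.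
-/
theorem ae_mark_atoms (hR : IsSimple R) (hH : H {0} = 0) :
    ∀ᵐ c ∂(mark R H), Set.InjOn (fun j => (c.2 j).1) (Set.Iio c.1) ∧ ∀ j < c.1, 0 < (c.2 j).2 := by
  have h1 : ∀ᵐ c ∂(mark R H), Set.InjOn (fun j => (c.2 j).1) (Set.Iio c.1) := by
    have hm : (mark R H).map (fun c => ((c.1, fun j => (c.2 j).1) : Config 𝕏)) = R := by
      rw [mark, Measure.map_map (by fun_prop) measurable_attach]
      exact Measure.fst_prod
    have h := hR
    rw [IsSimple, ← hm] at h
    exact ae_of_ae_map (by fun_prop) h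
  have h2 (j : ℕ) : ∀ᵐ c ∂(mark R H), 0 < (c.2 j).2 := by
    have hm : (mark R H).map (fun c => (c.2 j).2) = H := by
      rw [mark, Measure.map_map (by fun_prop) measurable_attach]
      change ((R.prod _).map ((fun s : ℕ → ℝ≥0 => s j) ∘ Prod.snd)) = H
      rw [← Measure.map_map (by fun_prop) measurable_snd, ← Measure.snd, Measure.snd_prod]
      exact Measure.infinitePi_map_eval (X := fun _ : ℕ => ℝ≥0) (fun _ => H) j
    have h : ∀ᵐ s ∂H, 0 < s := by
      rw [ae_iff]
      simpa using hH
    rw [← hm] at h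
    exact ae_of_ae_map (by fun_prop) h
  filter_upwards [h1, ae_all_iff.2 h2] with c h1 h2
  exact ⟨h1, fun j _ => h2 j⟩

theorem isNonActive_nonActive (hR : IsSimple R) (hH : H {0} = 0)
    (hu : 0 ≤ u) : IsNonActive R H u (nonActive R H u) where
  prob := isProbabilityMeasure_nonActive R H hu
  atoms := Measure.ae_smul_measure
    ((withDensity_absolutelyContinuous _ _).ae_le (ae_mark_atoms R H hR hH)) _
  laplace_eq f hf h0 := by
    have hmt : Measurable fun c : Config (𝕏 × ℝ≥0) =>
        Real.exp (-∑ j ∈ Finset.range c.1, ((c.2 j).2 : ℝ) * u) := by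
      have := (measurable_tilt_right (𝕏 := 𝕏) u).ennreal_toReal
      simpa only [tilt, ENNReal.toReal_ofReal (Real.exp_pos _).le] using this
    rw [laplace_map_atomic _ hf h0, laplace_map_atomic _ (by fun_prop)
      (fun x => add_nonneg (h0 x) hu), laplace_map_atomic _ measurable_const (fun _ => hu),
      nonActive, integral_smul_measure, integral_withDensity_eq_integral_toReal_smul
        (measurable_tilt_right u) (Filter.Eventually.of_forall fun c =>
          (tilt_le_one hu c).trans_lt ENNReal.one_lt_top),
      integral_eq_lintegral_of_nonneg_ae (f := fun c : Config (𝕏 × ℝ≥0) =>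
        Real.exp (-∑ j ∈ Finset.range c.1, ((c.2 j).2 : ℝ) * u))
        (Filter.Eventually.of_forall fun c => (Real.exp_pos _).le) hmt.aestronglyMeasurable,
      smul_eq_mul, ENNReal.toReal_inv, div_eq_inv_mul]
    congr 1
    -- The tilt times `exp (-∑ s f)` is `exp (-∑ s (f + u))`; the normalizing constant is the
    -- denominator of the ratio.
    refine integral_congr_ae (Filter.Eventually.of_forall fun c => ?_)
    simp only [tilt, ENNReal.toReal_ofReal (Real.exp_pos _).le, smul_eq_mul, mul_add,
      Finset.sum_add_distrib]
    rw [← Real.exp_add]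
    congr 1
    ring

end nonActive

/-! ### The posterior as a ratio -/

/-- The density `s ^ m * exp (-u s)`. -/
noncomputable def jumpDensity (u : ℝ) (m : ℕ) (s : ℝ≥0) : ℝ≥0∞ :=
  ENNReal.ofReal ((s : ℝ) ^ m * Real.exp (-(u * s)))

theorem measurable_jumpDensity :
    Measurable fun p : ℝ × ℕ × ℝ≥0 => jumpDensity p.1 p.2.1 p.2.2 := by
  unfold jumpDensity
  fun_prop

theorem measurable_jumpDensity_right (u : ℝ) (m : ℕ) : Measurable (jumpDensity u m) :=
  measurable_jumpDensity.comp (f := fun s : ℝ≥0 => (u, m, s)) (by fun_prop)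

/-- From `(u s) ^ m / m! ≤ exp (u s)`. The bound makes the jump laws normalizable without moment
assumptions on `H`. -/
theorem jumpDensity_le {u : ℝ} (hu : 0 < u) (m : ℕ) (s : ℝ≥0) :
    jumpDensity u m s ≤ ENNReal.ofReal (m.factorial / u ^ m) := by
  refine ENNReal.ofReal_le_ofReal ?_
  have h := Real.pow_div_factorial_le_exp (u * s) (by positivity) m
  rw [mul_pow, div_le_iff₀ (by positivity)] at h
  rw [Real.exp_neg, ← div_eq_mul_inv, div_le_div_iff₀ (Real.exp_pos _) (by positivity)]
  linarith

section jumpLaw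

variable (H : Measure ℝ≥0) [IsProbabilityMeasure H] {u : ℝ}

theorem lintegral_jumpDensity_ne_top (hu : 0 < u) (m : ℕ) :
    ∫⁻ s, jumpDensity u m s ∂H ≠ ∞ := by
  refine ne_of_lt (lt_of_le_of_lt (lintegral_mono fun s => jumpDensity_le hu m s) ?_)
  simp

theorem lintegral_jumpDensity_ne_zero (hH : H {0} = 0) (m : ℕ) :
    ∫⁻ s, jumpDensity u m s ∂H ≠ 0 := by
  rw [Ne, lintegral_eq_zero_iff (measurable_jumpDensity_right u m)]
  intro h
  have h' : ∀ᵐ s ∂H, 0 < s := by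
    rw [ae_iff]
    simpa using hH
  obtain ⟨s, hs, hs'⟩ := (h.and h').exists
  simp only [jumpDensity, Pi.zero_apply, ENNReal.ofReal_eq_zero] at hs
  have : (0 : ℝ) < (s : ℝ) ^ m * Real.exp (-(u * s)) := by positivity
  exact absurd hs (not_le.2 this)

theorem jumpLaw_eq (u : ℝ) (m : ℕ) : jumpLaw H u m =
    H.withDensity ((∫⁻ s, jumpDensity u m s ∂H)⁻¹ • jumpDensity u m) := by
  rw [withDensity_smul _ (measurable_jumpDensity_right u m)]
  rfl

theorem isProbabilityMeasure_jumpLaw (hH : H {0} = 0) (hu : 0 < u) (m : ℕ) :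
    IsProbabilityMeasure (jumpLaw H u m) := by
  refine ⟨?_⟩
  rw [jumpLaw_eq, withDensity_apply _ MeasurableSet.univ, setLIntegral_univ]
  simp only [Pi.smul_apply, smul_eq_mul]
  rw [lintegral_const_mul _ (measurable_jumpDensity_right u m),
    ENNReal.inv_mul_cancel (lintegral_jumpDensity_ne_zero H hH m)
      (lintegral_jumpDensity_ne_top H hu m)]

end jumpLaw

theorem measurable_posteriorSum {k : ℕ} (x : Fin k → 𝕏) (w : Fin k → 𝕎) :
    Measurable fun p : (Fin k → ℝ≥0) × Config ((𝕏 × ℝ≥0) × 𝕎) =>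
      (∑ h, (p.1 h : ℝ≥0∞) • Measure.dirac (x h, w h)) + markedAtomic p.2 :=
  (measurable_sum_smul_dirac _ (fun _ _ => by fun_prop) fun _ _ => by fun_prop).add
    (measurable_markedAtomic.comp measurable_snd)

/-- The integral of `g` with respect to the unnormalized posterior. -/
noncomputable def posteriorWeight {k : ℕ} (R : Measure (Config 𝕏)) (H : Measure ℝ≥0)
    [IsProbabilityMeasure H] (F : Measure 𝕎) [IsProbabilityMeasure F]
    (m : Fin k → ℕ) (x : Fin k → 𝕏) (w : Fin k → 𝕎) (u : ℝ)
    (g : Measure (𝕏 × 𝕎) → ℝ≥0∞) : ℝ≥0∞ :=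
  ∫⁻ c, ∫⁻ s, ∫⁻ s', ∫⁻ w', (∏ h, jumpDensity u (m h) (s h)) *
    tilt u (c.1, fun j => (c.2 j, s' j)) *
    g ((∑ h, (s h : ℝ≥0∞) • Measure.dirac (x h, w h)) +
      markedAtomic (c.1, fun j => ((c.2 j, s' j), w' j)))
    ∂(Measure.infinitePi fun _ : ℕ => F) ∂(Measure.infinitePi fun _ : ℕ => H)
    ∂(Measure.pi fun _ : Fin k => H) ∂(R)

/-! ### Normalization of the posterior weight -/

section posterior

variable {k : ℕ} (R : Measure (Config 𝕏)) [IsProbabilityMeasure R] (H : Measure ℝ≥0)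
  [IsProbabilityMeasure H] (F : Measure 𝕎) [IsProbabilityMeasure F]
  (m : Fin k → ℕ) (x : Fin k → 𝕏) (w : Fin k → 𝕎) {u : ℝ}

theorem isProbabilityMeasure_posterior (hH : H {0} = 0) (hu : 0 < u)
    (τ : Measure (Config (𝕏 × ℝ≥0))) [IsProbabilityMeasure τ] :
    IsProbabilityMeasure (posterior H F m x w u τ) := by
  have (h : Fin k) := isProbabilityMeasure_jumpLaw H hH hu (m h)
  exact Measure.isProbabilityMeasure_map (measurable_posteriorSum x w).aemeasurable

/-- Forget the marks. -/
def unmark (c : Config (E × S)) : Config E := (c.1, fun j => (c.2 j).1)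

theorem measurable_unmark : Measurable (unmark : Config (E × S) → Config E) := by
  unfold unmark
  fun_prop

/-- The tilt does not involve the marks, so tilting and marking commute. -/
theorem lintegral_mark_nonActive {g : Config ((𝕏 × ℝ≥0) × 𝕎) → ℝ≥0∞} (hg : Measurable g)
    (hu : 0 ≤ u) :
    ∫⁻ c, g c ∂(mark (nonActive R H u) F) = (∫⁻ c, tilt u c ∂(mark R H))⁻¹ *
      ∫⁻ c, tilt u (unmark c) * g c ∂(mark (mark R H) F) := by
  have := isProbabilityMeasure_nonActive R H hu
  have hI : Measurable fun c : Config (𝕏 × ℝ≥0) => ∫⁻ w', g (c.1, fun j => (c.2 j, w' j))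
      ∂(Measure.infinitePi fun _ : ℕ => F) :=
    (hg.comp measurable_attach).lintegral_prod_right'
  have ht := measurable_tilt_right (𝕏 := 𝕏) u
  rw [lintegral_mark _ _ hg, nonActive, lintegral_smul_measure, smul_eq_mul,
    lintegral_withDensity_eq_lintegral_mul _ ht hI,
    lintegral_mark _ F (G := fun c => tilt u (unmark c) * g c)
      (by exact (ht.comp measurable_unmark).mul hg)]
  congr 1
  refine lintegral_congr fun c => ?_
  simp only [Pi.mul_apply]
  rw [← lintegral_const_mul']
  · rfl
  · exact ENNReal.ofReal_ne_top

theorem measurable_prod_jumpDensity :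
    Measurable fun s : Fin k → ℝ≥0 => ∏ h, jumpDensity u (m h) (s h) :=
  Finset.measurable_prod _ fun h _ =>
    (measurable_jumpDensity_right u (m h)).comp (measurable_pi_apply h)

theorem measurable_tilt_mul {g : Measure (𝕏 × 𝕎) → ℝ≥0∞} (hg : Measurable g) :
    Measurable fun p : (Fin k → ℝ≥0) × Config ((𝕏 × ℝ≥0) × 𝕎) => tilt u (unmark p.2) *
      g ((∑ h, (p.1 h : ℝ≥0∞) • Measure.dirac (x h, w h)) + markedAtomic p.2) :=
  (((measurable_tilt_right u).comp measurable_unmark).comp measurable_snd).mul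
    (hg.comp (measurable_posteriorSum x w))

theorem posteriorWeight_eq {g : Measure (𝕏 × 𝕎) → ℝ≥0∞} (hg : Measurable g) :
    posteriorWeight R H F m x w u g =
      ∫⁻ s, (∏ h, jumpDensity u (m h) (s h)) * ∫⁻ c, tilt u (unmark c) *
        g ((∑ h, (s h : ℝ≥0∞) • Measure.dirac (x h, w h)) + markedAtomic c)
        ∂(mark (mark R H) F) ∂(Measure.pi fun _ : Fin k => H) := by
  have hG := (measurable_prod_jumpDensity (u := u) m).comp measurable_fst |>.mul
    (measurable_tilt_mul (u := u) x w hg)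
  have hK : Measurable fun p : ((Config 𝕏 × (Fin k → ℝ≥0)) × (ℕ → ℝ≥0)) × (ℕ → 𝕎) =>
      (∏ h, jumpDensity u (m h) (p.1.1.2 h)) *
      tilt u (p.1.1.1.1, fun j => (p.1.1.1.2 j, p.1.2 j)) *
      g ((∑ h, (p.1.1.2 h : ℝ≥0∞) • Measure.dirac (x h, w h)) +
        markedAtomic (p.1.1.1.1, fun j => ((p.1.1.1.2 j, p.1.2 j), p.2 j))) := by
    simp_rw [mul_assoc]
    exact hG.comp (f := fun p : ((Config 𝕏 × (Fin k → ℝ≥0)) × (ℕ → ℝ≥0)) × (ℕ → 𝕎) =>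
      (p.1.1.2, ((p.1.1.1.1, fun j => ((p.1.1.1.2 j, p.1.2 j), p.2 j)) :
        Config ((𝕏 × ℝ≥0) × 𝕎)))) (by fun_prop)
  rw [posteriorWeight, lintegral_lintegral_swap
    (by exact hK.lintegral_prod_right'.lintegral_prod_right'.aemeasurable)]
  refine lintegral_congr fun s => ?_
  have hgs := (measurable_tilt_mul (u := u) x w hg).comp (measurable_prodMk_left (x := s))
  have hne : ∏ h, jumpDensity u (m h) (s h) ≠ ∞ :=
    ENNReal.prod_ne_top fun h _ => ENNReal.ofReal_ne_top
  rw [← lintegral_const_mul' _ _ hne,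
    lintegral_mark _ _ (by exact hgs.const_mul _), lintegral_mark]
  · refine lintegral_congr fun c => lintegral_congr fun s' => lintegral_congr fun w' => ?_
    exact mul_assoc _ _ _
  · exact ((hgs.const_mul _).comp measurable_attach).lintegral_prod_right'

/-- What matters is that `z` does not depend on `g`: it collects the normalizing constants of the
active jumps and of the tilt, and its value follows later from `g = 1`. -/
theorem lintegral_posterior_eq_const_mul (hH : H {0} = 0) (hu : 0 < u) :
    ∃ z : ℝ≥0∞, ∀ g : Measure (𝕏 × 𝕎) → ℝ≥0∞, Measurable g →
      ∫⁻ μ, g μ ∂(posterior H F m x w u (nonActive R H u)) =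
        z * posteriorWeight R H F m x w u g := by
  have hτ := isProbabilityMeasure_nonActive R H hu.le
  have (h : Fin k) := isProbabilityMeasure_jumpLaw H hH hu (m h)
  refine ⟨(∏ h, (∫⁻ s, jumpDensity u (m h) s ∂H)⁻¹) * (∫⁻ c, tilt u c ∂(mark R H))⁻¹,
    fun g hg => ?_⟩
  have hpi : (Measure.pi fun h => jumpLaw H u (m h)) =
      (Measure.pi fun _ => H).withDensity fun s => ∏ h,
        ((∫⁻ s, jumpDensity u (m h) s ∂H)⁻¹ * jumpDensity u (m h) (s h)) := by
    simp_rw [jumpLaw_eq] at this ⊢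
    exact pi_withDensity H fun h => (measurable_jumpDensity_right u (m h)).const_smul _
  have hG := hg.comp (measurable_posteriorSum x w)
  have hA : Measurable fun s : Fin k → ℝ≥0 => ∫⁻ c, tilt u (unmark c) *
        g ((∑ h, (s h : ℝ≥0∞) • Measure.dirac (x h, w h)) + markedAtomic c)
        ∂(mark (mark R H) F) :=
    (measurable_tilt_mul x w hg).lintegral_prod_right'
  rw [posterior, lintegral_map hg (measurable_posteriorSum x w),
    lintegral_prod _ (by exact hG.aemeasurable)]
  refine (lintegral_congr fun s => lintegral_mark_nonActive R H F
    (hG.comp (measurable_prodMk_left (x := s))) hu.le).trans ?_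
  rw [posteriorWeight_eq R H F m x w hg, hpi, lintegral_withDensity_eq_lintegral_mul _ _
    (by exact hA.const_mul _), ← lintegral_const_mul]
  · refine lintegral_congr fun s => ?_
    simp only [Pi.mul_apply, Finset.prod_mul_distrib, Function.comp_apply]
    ring
  · exact (measurable_prod_jumpDensity m).mul hA
  · exact Finset.measurable_prod _ fun h _ =>
      ((measurable_jumpDensity_right u (m h)).comp (measurable_pi_apply h)).const_mul _

/-- The posterior is the normalization of the weight. -/
theorem posteriorWeight_eq_mul_lintegral (hH : H {0} = 0) (hu : 0 < u)
    {g : Measure (𝕏 × 𝕎) → ℝ≥0∞} (hg : Measurable g) :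
    posteriorWeight R H F m x w u g = posteriorWeight R H F m x w u 1 *
      ∫⁻ μ, g μ ∂(posterior H F m x w u (nonActive R H u)) ∧
    ∫⁻ μ, g μ ∂(posterior H F m x w u (nonActive R H u)) =
      (posteriorWeight R H F m x w u 1)⁻¹ * posteriorWeight R H F m x w u g := by
  obtain ⟨z, hz⟩ := lintegral_posterior_eq_const_mul R H F m x w hH hu
  have := isProbabilityMeasure_nonActive R H hu.le
  have := isProbabilityMeasure_posterior H F m x w hH hu (nonActive R H u)
  -- The posterior has total mass one; in particular the weight of `1` is neither zero nor infinite.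
  have h1 : z * posteriorWeight R H F m x w u 1 = 1 := by
    rw [← hz 1 measurable_one]
    simp
  have h2 : z = (posteriorWeight R H F m x w u 1)⁻¹ := ENNReal.eq_inv_of_mul_eq_one_left h1
  refine ⟨?_, by rw [hz g hg, h2]⟩
  rw [hz g hg, ← mul_assoc, mul_comm _ z, h1, one_mul]

end posterior

/-! ### The joint law of the model -/

/-- Tonelli brings the integrals into the order of the mixture formula, and the sequences of jumps
and marks are split into active and remaining entries. -/
theorem lintegral_marks_split {V : Type*} [MeasurableSpace V] (ν : Measure V) [SFinite ν]
    (H : Measure S) [IsProbabilityMeasure H] (F : Measure 𝕎) [IsProbabilityMeasure F] {k : ℕ}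
    (a : Fin k ↪ ℕ)
    {K : (((V × (Fin k → 𝕎)) × (Fin k → S)) × (ℕ → S)) × (ℕ → 𝕎) → ℝ≥0∞} (hK : Measurable K) :
    ∫⁻ s, ∫⁻ w, ∫⁻ u, K ((((u, fun h => w (a h)), fun h => s (a h)), fun j => s (complEnum a j)),
        fun j => w (complEnum a j)) ∂ν ∂(Measure.infinitePi fun _ : ℕ => F)
        ∂(Measure.infinitePi fun _ : ℕ => H) =
      ∫⁻ u, ∫⁻ w, ∫⁻ s, ∫⁻ s', ∫⁻ w', K ((((u, w), s), s'), w')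
        ∂(Measure.infinitePi fun _ : ℕ => F) ∂(Measure.infinitePi fun _ : ℕ => H)
        ∂(Measure.pi fun _ : Fin k => H) ∂(Measure.pi fun _ : Fin k => F) ∂ν := by
  have hab := sumElim_complEnum_injective a
  have hm : Measurable fun p : ((ℕ → S) × V) × (ℕ → 𝕎) =>
      K ((((p.1.2, fun h => p.2 (a h)), fun h => p.1.1 (a h)), fun j => p.1.1 (complEnum a j)),
        fun j => p.2 (complEnum a j)) := hK.comp (by fun_prop)
  calc _ = ∫⁻ s, ∫⁻ u, ∫⁻ w, K ((((u, fun h => w (a h)), fun h => s (a h)),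
          fun j => s (complEnum a j)), fun j => w (complEnum a j))
          ∂(Measure.infinitePi fun _ : ℕ => F) ∂ν ∂(Measure.infinitePi fun _ : ℕ => H) := by
        refine lintegral_congr fun s => lintegral_lintegral_swap ?_
        exact (hm.comp (f := fun p : (ℕ → 𝕎) × V => ((s, p.2), p.1)) (by fun_prop)).aemeasurable
    _ = ∫⁻ u, ∫⁻ s, ∫⁻ w, K ((((u, fun h => w (a h)), fun h => s (a h)),
          fun j => s (complEnum a j)), fun j => w (complEnum a j))
          ∂(Measure.infinitePi fun _ : ℕ => F) ∂(Measure.infinitePi fun _ : ℕ => H) ∂ν :=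
        lintegral_lintegral_swap hm.lintegral_prod_right'.aemeasurable
    _ = _ := by
        refine lintegral_congr fun u => ?_
        calc _ = ∫⁻ s, ∫⁻ w, ∫⁻ w', K ((((u, w), fun h => s (a h)),
                fun j => s (complEnum a j)), w') ∂(Measure.infinitePi fun _ : ℕ => F)
                ∂(Measure.pi fun _ : Fin k => F) ∂(Measure.infinitePi fun _ : ℕ => H) := by
              refine lintegral_congr fun s => ?_
              refine lintegral_infinitePi_split F hab (G := fun w w' => K ((((u, w),
                fun h => s (a h)), fun j => s (complEnum a j)), w')) ?_
              exact hK.comp (f := fun p : (Fin k → 𝕎) × (ℕ → 𝕎) => ((((u, p.1),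
                fun h => s (a h)), fun j => s (complEnum a j)), p.2)) (by fun_prop)
          _ = ∫⁻ w, ∫⁻ s, ∫⁻ w', K ((((u, w), fun h => s (a h)),
                fun j => s (complEnum a j)), w') ∂(Measure.infinitePi fun _ : ℕ => F)
                ∂(Measure.infinitePi fun _ : ℕ => H) ∂(Measure.pi fun _ : Fin k => F) := by
              refine lintegral_lintegral_swap (Measurable.aemeasurable ?_)
              exact (hK.comp (f := fun p : ((ℕ → S) × (Fin k → 𝕎)) × (ℕ → 𝕎) => ((((u, p.1.2),
                fun h => p.1.1 (a h)), fun j => p.1.1 (complEnum a j)), p.2))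
                (by fun_prop)).lintegral_prod_right'
          _ = _ := by
              refine lintegral_congr fun w => ?_
              refine lintegral_infinitePi_split H hab (G := fun s s' => ∫⁻ w', K ((((u, w),
                s), s'), w') ∂(Measure.infinitePi fun _ : ℕ => F)) ?_
              exact (hK.comp (f := fun p : ((Fin k → S) × (ℕ → S)) × (ℕ → 𝕎) => ((((u, w),
                p.1.1), p.1.2), p.2)) (by fun_prop)).lintegral_prod_right'

theorem categorical_singleton (c : Config ((𝕏 × ℝ≥0) × 𝕎)) (j : ℕ) :
    categorical c {j} =
      if j < c.1 then ((c.2 j).1.2 : ℝ≥0∞) / (totalMass c : ℝ≥0∞) else 0 := by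
  change (∑ i ∈ Finset.range c.1, (((c.2 i).1.2 : ℝ≥0∞) / (totalMass c : ℝ≥0∞)) •
    (Measure.dirac i : Measure ℕ)) {j} = _
  simp only [Measure.finsetSum_apply, Measure.smul_apply, smul_eq_mul,
    Measure.dirac_apply' _ (measurableSet_singleton j), Set.indicator_apply,
    Set.mem_singleton_iff, Pi.one_apply, mul_ite, mul_one, mul_zero, Finset.sum_ite_eq',
    Finset.mem_range]

instance {n : ℕ} {α β : Type*} [MeasurableSpace α] [MeasurableSpace β]
    (κ : Fin n → Kernel α β) [∀ i, IsMarkovKernel (κ i)] : IsMarkovKernel (piKernel κ) :=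
  ⟨fun a => (inferInstance : IsProbabilityMeasure (Measure.pi fun i => κ i a))⟩

/-! ### Labels and auxiliary variable given the configuration -/

section model

variable (Φ : Measure (Config 𝕏)) [IsProbabilityMeasure Φ]
    (H : Measure ℝ≥0) [IsProbabilityMeasure H] (F : Measure 𝕎) [IsProbabilityMeasure F]
    (f : Kernel (𝕏 × 𝕎) Z) [IsMarkovKernel f] {n k : ℕ}

/-- The observations integrate out because their kernel is Markov, and the labels range over a
countable set. -/
theorem lintegral_model {g : (Config ((𝕏 × ℝ≥0) × 𝕎) × (Fin n → ℕ)) × ℝ → ℝ≥0∞}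
    (hg : Measurable g) :
    ∫⁻ ω, g ω.1 ∂(model Φ H F f n) = ∑' J : Fin n → ℕ, ∫⁻ c, (∏ i, categorical c {J i}) *
      (∫⁻ u, gammaPDF n (totalMass c) u * g ((c, J), u)) ∂(mark (mark Φ H) F) := by
  have hfst : (model Φ H F f n).fst = ((mark (mark Φ H) F) ⊗ₘ
      (piKernel fun _ : Fin n => categorical)) ⊗ₘ
      ((gammaKernel n).comap Prod.fst measurable_fst) := Measure.fst_compProd _ _
  rw [← lintegral_map hg measurable_fst]
  change ∫⁻ p, g p ∂(model Φ H F f n).fst = _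
  have h1 : Measurable fun p : Config ((𝕏 × ℝ≥0) × 𝕎) × (Fin n → ℕ) =>
      ∫⁻ u, g (p, u) ∂(gammaKernel n p.1) :=
    hg.lintegral_kernel_prod_right' (κ := (gammaKernel n).comap Prod.fst measurable_fst)
  rw [hfst, Measure.lintegral_compProd hg]
  simp only [Kernel.comap_apply]
  rw [Measure.lintegral_compProd h1]
  have h2 (c : Config ((𝕏 × ℝ≥0) × 𝕎)) (J : Fin n → ℕ) :
      ∫⁻ u, g ((c, J), u) ∂(gammaKernel n c) =
        ∫⁻ u, gammaPDF n (totalMass c) u * g ((c, J), u) := by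
    change ∫⁻ u, g ((c, J), u) ∂(volume.withDensity (gammaPDF n (totalMass c))) = _
    have hγ : Measurable (gammaPDF n (totalMass c)) :=
      (measurable_gammaPDFReal _ _).ennreal_ofReal
    exact lintegral_withDensity_eq_lintegral_mul _ hγ
      (hg.comp (measurable_prodMk_left (x := (c, J))))
  rw [← lintegral_tsum]
  · refine lintegral_congr fun c => ?_
    rw [lintegral_countable']
    refine tsum_congr fun J => ?_
    rw [h2, mul_comm]
    congr 1
    exact Measure.pi_singleton _ _
  · intro J
    refine Measurable.aemeasurable (Measurable.mul ?_ ?_)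
    · exact Finset.measurable_prod _ fun i _ => Kernel.measurable_coe _ (measurableSet_singleton _)
    · simp_rw [← h2]
      exact h1.comp (f := fun c : Config ((𝕏 × ℝ≥0) × 𝕎) => (c, J))
        (measurable_id.prodMk measurable_const)

/-- The measure with density `u ^ (n - 1) / Γ (n)` on `(0, ∞)`. -/
noncomputable def auxMeasure (n : ℕ) : Measure ℝ :=
  volume.withDensity fun u =>
    if 0 < u then ENNReal.ofReal (u ^ ((n : ℝ) - 1) / Real.Gamma n) else 0

theorem measurable_auxDensity (n : ℕ) : Measurable fun u : ℝ =>
    if 0 < u then ENNReal.ofReal (u ^ ((n : ℝ) - 1) / Real.Gamma n) else 0 :=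
  Measurable.ite measurableSet_Ioi (by fun_prop) measurable_const

instance (n : ℕ) : SFinite (auxMeasure n) := by
  unfold auxMeasure
  infer_instance

theorem ae_auxMeasure (n : ℕ) : ∀ᵐ u ∂(auxMeasure n), 0 < u := by
  rw [auxMeasure, ae_withDensity_iff (measurable_auxDensity n)]
  refine Filter.Eventually.of_forall fun u hu => ?_
  by_contra h
  simp [h] at hu

/-- Every active component receives an observation, and a label beyond the number of points has
probability zero. -/
theorem prod_categorical_eq_zero (C : Allocation n k) {a : Fin k ↪ ℕ}
    {c : Config ((𝕏 × ℝ≥0) × 𝕎)} (ha : ¬ ∀ h, a h < c.1) :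
    ∏ i, categorical c {C.labels a i} = 0 := by
  obtain ⟨h, hh⟩ := not_forall.1 ha
  obtain ⟨i, hi⟩ := C.exists_eq h
  refine Finset.prod_eq_zero (Finset.mem_univ i) ?_
  have e : C.labels a i = a h := congrArg a (Fin.ext hi)
  rw [categorical_singleton, e, if_neg hh]

/-- This is the cancellation of `T ^ n` on which the factorization rests. The point `u = 0` is
excluded because for `n = 1` the gamma density is `T` there, while the reference density is set to
zero. -/
theorem prod_categorical_mul_gammaPDF (hn : 1 ≤ n) (C : Allocation n k) {a : Fin k ↪ ℕ}
    {c : Config ((𝕏 × ℝ≥0) × 𝕎)} (ha : ∀ h, a h < c.1) {u : ℝ} (hu : u ≠ 0) :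
    (∏ i, categorical c {C.labels a i}) * gammaPDF n (totalMass c) u =
      (if 0 < u then ENNReal.ofReal (u ^ ((n : ℝ) - 1) / Real.Gamma n) else 0) *
      ((∏ h : Fin k, jumpDensity u (clusterSize C.1 h) (c.2 (a h)).1.2) *
        tilt u (remove a (unmark c))) := by
  rcases lt_or_gt_of_ne hu with hu | hu
  · rw [gammaPDF_of_neg hu, if_neg hu.not_gt, mul_zero, zero_mul]
  have hlt (i : Fin n) : C.labels a i < c.1 := ha _
  have hcat (i : Fin n) : categorical c {C.labels a i} =
      ((c.2 (C.labels a i)).1.2 : ℝ≥0∞) / (totalMass c : ℝ≥0∞) := by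
    rw [categorical_singleton, if_pos (hlt i)]
  simp_rw [hcat]
  rw [if_pos hu, gammaPDF_of_nonneg hu.le]
  -- For `T = 0` both sides vanish: all label probabilities are zero, and some cluster is nonempty,
  -- so a positive power of a zero jump appears.
  rcases eq_or_ne (totalMass c) 0 with hT | hT
  · have h0 (j : ℕ) (hj : j < c.1) : (c.2 j).1.2 = 0 :=
      (Finset.sum_eq_zero_iff.1 hT) j (Finset.mem_range.2 hj)
    have hl : ∏ i, (((c.2 (C.labels a i)).1.2 : ℝ≥0∞) / (totalMass c : ℝ≥0∞)) = 0 := by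
      refine Finset.prod_eq_zero (Finset.mem_univ ⟨0, hn⟩) ?_
      rw [h0 _ (hlt _)]
      simp
    have hr : ∏ h : Fin k, jumpDensity u (clusterSize C.1 h) (c.2 (a h)).1.2 = 0 := by
      refine Finset.prod_eq_zero (Finset.mem_univ ⟨0, C.pos hn⟩) ?_
      obtain ⟨i, hi⟩ := C.exists_eq ⟨0, C.pos hn⟩
      have : clusterSize C.1 (⟨0, C.pos hn⟩ : Fin k) ≠ 0 :=
        (Finset.card_pos.2 ⟨i, by simpa using hi⟩).ne'
      rw [h0 _ (ha _), jumpDensity, NNReal.coe_zero, zero_pow this, zero_mul, ENNReal.ofReal_zero]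
    rw [hl, hr]
    simp
  · have hTpos : (0 : ℝ) < totalMass c := by exact_mod_cast pos_iff_ne_zero.2 hT
    have hdiv (s : ℝ≥0) : (s : ℝ≥0∞) / (totalMass c : ℝ≥0∞) =
        ENNReal.ofReal ((s : ℝ) / totalMass c) := by
      rw [ENNReal.ofReal_div_of_pos hTpos, ENNReal.ofReal_coe_nnreal, ENNReal.ofReal_coe_nnreal]
    have hΓ : 0 < Real.Gamma n := Real.Gamma_pos_of_pos (by exact_mod_cast hn)
    have hsum : (totalMass c : ℝ) = ∑ h, ((c.2 (a h)).1.2 : ℝ) +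
        ∑ j ∈ Finset.range (c.1 - k), ((c.2 (complEnum a j)).1.2 : ℝ) := by
      rw [totalMass, NNReal.coe_sum]
      exact sum_range_split a ha fun j => ((c.2 j).1.2 : ℝ)
    simp_rw [hdiv, jumpDensity, tilt]
    rw [← ENNReal.ofReal_prod_of_nonneg fun i _ => by positivity,
      ← ENNReal.ofReal_prod_of_nonneg fun i _ => by positivity,
      ← ENNReal.ofReal_mul (Finset.prod_nonneg fun i _ => by positivity),
      ← ENNReal.ofReal_mul (Finset.prod_nonneg fun i _ => by positivity),
      ← ENNReal.ofReal_mul (by positivity)]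
    congr 1
    rw [Finset.prod_div_distrib, Finset.prod_const, Finset.card_univ, Fintype.card_fin,
      C.prod_labels a fun j => ((c.2 j).1.2 : ℝ), Finset.prod_mul_distrib, ← Real.exp_sum,
      mul_assoc (∏ h, _), ← Real.exp_add, Real.rpow_natCast]
    -- The exponents of the active jumps and of the tilt recombine to `-T u`.
    have he : ∑ h, -(u * ((c.2 (a h)).1.2 : ℝ)) +
        -∑ j ∈ Finset.range (remove a (unmark c)).1, ((remove a (unmark c)).2 j).2 * u =
        -(totalMass c * u) := by
      rw [hsum, Finset.sum_neg_distrib, ← Finset.mul_sum, ← Finset.sum_mul]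
      change -(u * _) + -((∑ j ∈ Finset.range (c.1 - k),
        ((c.2 (complEnum a j)).1.2 : ℝ)) * u) = _
      ring
    rw [he]
    field_simp

end model

/-! ### Integration of functions of the conditioning variables and the random measure -/

section weights

variable {n k : ℕ} (H : Measure ℝ≥0) [IsProbabilityMeasure H] (F : Measure 𝕎)
  [IsProbabilityMeasure F]

/-- The integrand of `posteriorWeight`. -/
noncomputable def weightIntegrand
    (G : ((Fin n → ℕ) × (Fin k → 𝕏) × (Fin k → 𝕎) × ℝ) × Measure (𝕏 × 𝕎) → ℝ≥0∞)
    (p : (((((Fin n → ℕ) × (Fin k → 𝕏) × (Fin k → 𝕎) × ℝ) × Config 𝕏) × (Fin k → ℝ≥0)) ×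
      (ℕ → ℝ≥0)) × (ℕ → 𝕎)) : ℝ≥0∞ :=
  (∏ h : Fin k, jumpDensity p.1.1.1.1.2.2.2 (clusterSize p.1.1.1.1.1 h) (p.1.1.2 h)) *
    tilt p.1.1.1.1.2.2.2 (p.1.1.1.2.1, fun j => (p.1.1.1.2.2 j, p.1.2 j)) *
    G (p.1.1.1.1, (∑ h, (p.1.1.2 h : ℝ≥0∞) •
      Measure.dirac (p.1.1.1.1.2.1 h, p.1.1.1.1.2.2.1 h)) +
      markedAtomic (p.1.1.1.2.1, fun j => ((p.1.1.1.2.2 j, p.1.2 j), p.2 j)))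

theorem measurable_weightIntegrand
    {G : ((Fin n → ℕ) × (Fin k → 𝕏) × (Fin k → 𝕎) × ℝ) × Measure (𝕏 × 𝕎) → ℝ≥0∞}
    (hG : Measurable G) : Measurable (weightIntegrand G) := by
  unfold weightIntegrand
  refine (Measurable.mul ?_ ?_).mul ?_
  · refine Finset.measurable_prod _ fun h _ => ?_
    have hc : Measurable fun C : Fin n → ℕ => clusterSize C h := measurable_of_countable _
    exact measurable_jumpDensity.comp (f := fun p : (((((Fin n → ℕ) × (Fin k → 𝕏) ×
      (Fin k → 𝕎) × ℝ) × Config 𝕏) × (Fin k → ℝ≥0)) × (ℕ → ℝ≥0)) × (ℕ → 𝕎) =>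
      (p.1.1.1.1.2.2.2, clusterSize p.1.1.1.1.1 h, p.1.1.2 h)) (by fun_prop)
  · exact measurable_tilt.comp (f := fun p : (((((Fin n → ℕ) × (Fin k → 𝕏) ×
      (Fin k → 𝕎) × ℝ) × Config 𝕏) × (Fin k → ℝ≥0)) × (ℕ → ℝ≥0)) × (ℕ → 𝕎) =>
      (p.1.1.1.1.2.2.2, ((p.1.1.1.2.1, fun j => (p.1.1.1.2.2 j, p.1.2 j)) :
        Config (𝕏 × ℝ≥0)))) (by fun_prop)
  · refine hG.comp (Measurable.prodMk (by fun_prop) (Measurable.add ?_ ?_))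
    · exact measurable_sum_smul_dirac _ (fun _ _ => by fun_prop) fun _ _ => by fun_prop
    · exact measurable_markedAtomic.comp (f := fun p : (((((Fin n → ℕ) × (Fin k → 𝕏) ×
        (Fin k → 𝕎) × ℝ) × Config 𝕏) × (Fin k → ℝ≥0)) × (ℕ → ℝ≥0)) × (ℕ → 𝕎) =>
        ((p.1.1.1.2.1, fun j => ((p.1.1.1.2.2 j, p.1.2 j), p.2 j)) :
          Config ((𝕏 × ℝ≥0) × 𝕎))) (by fun_prop)

/-- The contribution of a configuration of non-active points to `posteriorWeight`. -/
noncomputable def configWeight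
    (G : ((Fin n → ℕ) × (Fin k → 𝕏) × (Fin k → 𝕎) × ℝ) × Measure (𝕏 × 𝕎) → ℝ≥0∞)
    (q : ((Fin n → ℕ) × (Fin k → 𝕏) × (Fin k → 𝕎) × ℝ) × Config 𝕏) : ℝ≥0∞ :=
  ∫⁻ s, ∫⁻ s', ∫⁻ w', weightIntegrand G (((q, s), s'), w')
    ∂(Measure.infinitePi fun _ : ℕ => F) ∂(Measure.infinitePi fun _ : ℕ => H)
    ∂(Measure.pi fun _ : Fin k => H)

theorem measurable_configWeight
    {G : ((Fin n → ℕ) × (Fin k → 𝕏) × (Fin k → 𝕎) × ℝ) × Measure (𝕏 × 𝕎) → ℝ≥0∞}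
    (hG : Measurable G) : Measurable (configWeight H F G) :=
  (measurable_weightIntegrand hG).lintegral_prod_right'.lintegral_prod_right'.lintegral_prod_right'

theorem posteriorWeight_eq_lintegral_configWeight (R : Measure (Config 𝕏))
    (G : ((Fin n → ℕ) × (Fin k → 𝕏) × (Fin k → 𝕎) × ℝ) × Measure (𝕏 × 𝕎) → ℝ≥0∞)
    (θ : (Fin n → ℕ) × (Fin k → 𝕏) × (Fin k → 𝕎) × ℝ) :
    posteriorWeight R H F (fun h => clusterSize θ.1 h) θ.2.1 θ.2.2.1 θ.2.2.2
      (fun μ => G (θ, μ)) = ∫⁻ c, configWeight H F G (θ, c) ∂(R) := rfl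

theorem sum_range_perm {A : Type*} [AddCommMonoid A] {m : ℕ} {σ : Equiv.Perm ℕ}
    (hσ : ∀ j, σ j < m ↔ j < m) (g : ℕ → A) :
    ∑ j ∈ Finset.range m, g (σ j) = ∑ j ∈ Finset.range m, g j :=
  Finset.sum_equiv σ (fun j => by simpa using (hσ j).symm) fun _ _ => rfl

/-- A permutation of the points can be transferred to the jumps and marks, whose i.i.d. laws it
preserves. -/
theorem configWeight_congr [MeasurableSingletonClass 𝕏]
    {G : ((Fin n → ℕ) × (Fin k → 𝕏) × (Fin k → 𝕎) × ℝ) × Measure (𝕏 × 𝕎) → ℝ≥0∞}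
    (hG : Measurable G) (θ : (Fin n → ℕ) × (Fin k → 𝕏) × (Fin k → 𝕎) × ℝ) {c c' : Config 𝕏}
    (h : counting c = counting c') : configWeight H F G (θ, c) = configWeight H F G (θ, c') := by
  obtain ⟨hm, σ, hσ, hx⟩ := exists_perm_of_counting_eq h
  obtain ⟨m, x⟩ := c
  obtain ⟨m', x'⟩ := c'
  obtain rfl : m = m' := hm
  have key (s : Fin k → ℝ≥0) (s' : ℕ → ℝ≥0) (w' : ℕ → 𝕎) :
      weightIntegrand G ((((θ, (m, x')), s), s'), w') =
        weightIntegrand G ((((θ, (m, x)), s), fun j => s' (σ j)), fun j => w' (σ j)) := by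
    simp only [weightIntegrand, tilt, markedAtomic]
    congr 3
    · rw [← sum_range_perm hσ fun j => (s' j : ℝ) * θ.2.2.2]
    · congr 1
      rw [← sum_range_perm hσ fun j => (s' j : ℝ≥0∞) • Measure.dirac (x' j, w' j)]
      refine Finset.sum_congr rfl fun j hj => ?_
      rw [show x' (σ j) = x j from hx j (Finset.mem_range.1 hj)]
  have hK := measurable_weightIntegrand hG
  refine lintegral_congr fun s => ?_
  simp_rw [key]
  have h1 (s' : ℕ → ℝ≥0) : ∫⁻ w', weightIntegrand G ((((θ, (m, x)), s), s'),
      fun j => w' (σ j)) ∂(Measure.infinitePi fun _ : ℕ => F) =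
      ∫⁻ w', weightIntegrand G ((((θ, (m, x)), s), s'), w')
        ∂(Measure.infinitePi fun _ : ℕ => F) := by
    conv_rhs => rw [← infinitePi_map_comp F σ.injective]
    rw [lintegral_map (by exact hK.comp measurable_prodMk_left) (by fun_prop)]
  simp_rw [h1]
  conv_lhs => rw [← infinitePi_map_comp H σ.injective]
  rw [lintegral_map _ (by fun_prop)]
  exact (hK.comp (f := fun p : (ℕ → ℝ≥0) × (ℕ → 𝕎) => ((((θ, (m, x)), s), p.1), p.2))
    (by fun_prop)).lintegral_prod_right'

end weights

/-! ### The joint law as a mixture of posterior weights -/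

section model

variable (Φ : Measure (Config 𝕏)) [IsProbabilityMeasure Φ]
    (H : Measure ℝ≥0) [IsProbabilityMeasure H] (F : Measure 𝕎) [IsProbabilityMeasure F]
    (f : Kernel (𝕏 × 𝕎) Z) [IsMarkovKernel f] {n k : ℕ}

theorem prod_categorical_mul_lintegral (hn : 1 ≤ n)
    {G : ((Fin n → ℕ) × (Fin k → 𝕏) × (Fin k → 𝕎) × ℝ) × Measure (𝕏 × 𝕎) → ℝ≥0∞}
    (hG : Measurable G) (C : Allocation n k) (a : Fin k ↪ ℕ) (c : Config ((𝕏 × ℝ≥0) × 𝕎)) :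
    (∏ i, categorical c {C.labels a i}) * (∫⁻ u, gammaPDF n (totalMass c) u *
        G ((C.1, fun h => (c.2 (a h)).1.1, fun h => (c.2 (a h)).2, u), markedAtomic c)) =
      {c : Config ((𝕏 × ℝ≥0) × 𝕎) | ∀ h, a h < c.1}.indicator (fun c =>
        ∫⁻ u, weightIntegrand G (((((C.1, fun h => (c.2 (a h)).1.1, fun h => (c.2 (a h)).2, u),
          remove a (unmark (unmark c))), fun h => (c.2 (a h)).1.2),
          fun j => (c.2 (complEnum a j)).1.2), fun j => (c.2 (complEnum a j)).2)
          ∂(auxMeasure n)) c := by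
  by_cases ha : ∀ h, a h < c.1
  swap
  · rw [Set.indicator_of_notMem (by exact ha), prod_categorical_eq_zero C ha, zero_mul]
  rw [Set.indicator_of_mem (by exact ha)]
  have hG' : Measurable fun u : ℝ =>
      G ((C.1, fun h => (c.2 (a h)).1.1, fun h => (c.2 (a h)).2, u), markedAtomic c) :=
    hG.comp (by fun_prop)
  have hγ : Measurable (gammaPDF n (totalMass c)) := (measurable_gammaPDFReal _ _).ennreal_ofReal
  have hK : Measurable fun u : ℝ => weightIntegrand G (((((C.1, fun h => (c.2 (a h)).1.1,
      fun h => (c.2 (a h)).2, u), remove a (unmark (unmark c))), fun h => (c.2 (a h)).1.2),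
      fun j => (c.2 (complEnum a j)).1.2), fun j => (c.2 (complEnum a j)).2) :=
    (measurable_weightIntegrand hG).comp (by fun_prop)
  rw [← lintegral_const_mul _ (by exact hγ.mul hG'), auxMeasure,
    lintegral_withDensity_eq_lintegral_mul _ (measurable_auxDensity n) hK]
  refine lintegral_congr_ae ?_
  -- The densities may disagree at `u = 0`, which is a Lebesgue null set.
  filter_upwards [Measure.ae_ne volume (0 : ℝ)] with u hu
  have hma : markedAtomic c = (∑ h, ((c.2 (a h)).1.2 : ℝ≥0∞) •
      Measure.dirac ((c.2 (a h)).1.1, (c.2 (a h)).2)) + markedAtomic (c.1 - k,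
        fun j => (((c.2 (complEnum a j)).1.1, (c.2 (complEnum a j)).1.2),
          (c.2 (complEnum a j)).2)) :=
    sum_range_split a ha fun j => ((c.2 j).1.2 : ℝ≥0∞) • Measure.dirac ((c.2 j).1.1, (c.2 j).2)
  rw [← mul_assoc, prod_categorical_mul_gammaPDF hn C ha hu, mul_assoc, hma]
  rfl

theorem measurable_conditioning :
    Measurable (conditioning k : Sample 𝕏 𝕎 Z n → _) := by
  have hJ : Measurable fun ω : Sample 𝕏 𝕎 Z n => ω.1.1.2 := by fun_prop
  have hj (h : ℕ) : Measurable fun J : Fin n → ℕ => (activeLabels J).getD h 0 :=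
    measurable_of_countable _
  have hC : Measurable (alloc : (Fin n → ℕ) → Fin n → ℕ) := measurable_of_countable _
  refine (hC.comp hJ).prodMk (Measurable.prodMk ?_ (Measurable.prodMk ?_ (by fun_prop)))
  · exact measurable_pi_lambda _ fun h => measurable_of_index
      (g := fun j (ω : Sample 𝕏 𝕎 Z n) => (ω.1.1.1.2 j).1.1) ((hj h).comp hJ)
      fun _ => by fun_prop
  · exact measurable_pi_lambda _ fun h => measurable_of_index
      (g := fun j (ω : Sample 𝕏 𝕎 Z n) => (ω.1.1.1.2 j).2) ((hj h).comp hJ)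
      fun _ => by fun_prop

theorem measurable_randomMeasure :
    Measurable (randomMeasure : Sample 𝕏 𝕎 Z n → Measure (𝕏 × 𝕎)) :=
  measurable_markedAtomic.comp (by fun_prop)

theorem measurableSet_numActive : MeasurableSet {J : Fin n → ℕ | numActive J = k} :=
  MeasurableSet.of_discrete

theorem lintegral_modelOn_eq_tsum
    {g : (Config ((𝕏 × ℝ≥0) × 𝕎) × (Fin n → ℕ)) × ℝ → ℝ≥0∞} (hg : Measurable g) :
    ∫⁻ ω, g ω.1 ∂(modelOn Φ H F f n k) = ∑' (C : Allocation n k) (a : Fin k ↪ ℕ),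
      ∫⁻ c, (∏ i, categorical c {C.labels a i}) *
        (∫⁻ u, gammaPDF n (totalMass c) u * g ((c, C.labels a), u)) ∂(mark (mark Φ H) F) := by
  have hs : MeasurableSet {q : (Config ((𝕏 × ℝ≥0) × 𝕎) × (Fin n → ℕ)) × ℝ |
      numActive q.1.2 = k} :=
    measurableSet_numActive.preimage (measurable_snd.comp measurable_fst)
  have h1 := lintegral_model Φ H F f (hg.indicator hs)
  have h2 : ∫⁻ ω, g ω.1 ∂(modelOn Φ H F f n k) = ∫⁻ ω : Sample 𝕏 𝕎 Z n,
      {q : (Config ((𝕏 × ℝ≥0) × 𝕎) × (Fin n → ℕ)) × ℝ | numActive q.1.2 = k}.indicator g ω.1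
        ∂(model Φ H F f n) :=
    (lintegral_indicator (hs.preimage measurable_fst) fun ω : Sample 𝕏 𝕎 Z n => g ω.1).symm
  rw [h2, h1, ← ENNReal.tsum_prod, ← tsum_subtype_eq_of_support_subset
    (s := {J : Fin n → ℕ | numActive J = k})]
  · refine ((Allocation.labelsEquiv n k).tsum_eq fun J => ∫⁻ c, (∏ i, categorical c {J.1 i}) *
      (∫⁻ u, gammaPDF n (totalMass c) u *
        {q : (Config ((𝕏 × ℝ≥0) × 𝕎) × (Fin n → ℕ)) × ℝ | numActive q.1.2 = k}.indicator g
          ((c, J.1), u)) ∂(mark (mark Φ H) F)).symm.trans ?_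
    refine tsum_congr fun p => lintegral_congr fun c => ?_
    congr 1
    refine lintegral_congr fun u => ?_
    rw [Set.indicator_of_mem]
    · rfl
    · exact p.1.numActive_labels p.2
  · intro J hJ
    by_contra h
    refine hJ ?_
    have h' (c : Config ((𝕏 × ℝ≥0) × 𝕎)) (u : ℝ) :
        {q : (Config ((𝕏 × ℝ≥0) × 𝕎) × (Fin n → ℕ)) × ℝ | numActive q.1.2 = k}.indicator g
          ((c, J), u) = 0 := Set.indicator_of_notMem (by exact h) _
    simp [h']

/-- The sum over the labels of the active components is the sum defining `enumCampbell`, with the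
jumps and marks integrated out. -/
theorem lintegral_labels (hn : 1 ≤ n)
    {G : ((Fin n → ℕ) × (Fin k → 𝕏) × (Fin k → 𝕎) × ℝ) × Measure (𝕏 × 𝕎) → ℝ≥0∞}
    (hG : Measurable G) (C : Allocation n k) :
    ∑' a : Fin k ↪ ℕ, ∫⁻ c, (∏ i, categorical c {C.labels a i}) *
        (∫⁻ u, gammaPDF n (totalMass c) u *
          G ((C.1, fun h => (c.2 (a h)).1.1, fun h => (c.2 (a h)).2, u), markedAtomic c))
        ∂(mark (mark Φ H) F) =
      ∫⁻ p, ∫⁻ u, ∫⁻ w, configWeight H F G ((C.1, p.1, w, u), p.2)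
        ∂(Measure.pi fun _ : Fin k => F) ∂(auxMeasure n) ∂(enumCampbell Φ k) := by
  have hW : Measurable fun p : (Fin k → 𝕏) × Config 𝕏 =>
      ∫⁻ u, ∫⁻ w, configWeight H F G ((C.1, p.1, w, u), p.2)
        ∂(Measure.pi fun _ : Fin k => F) ∂(auxMeasure n) :=
    ((measurable_configWeight H F hG).comp (f := fun p : (((Fin k → 𝕏) × Config 𝕏) × ℝ) ×
      (Fin k → 𝕎) => ((C.1, p.1.1.1, p.2, p.1.2), p.1.1.2))
      (by fun_prop)).lintegral_prod_right'.lintegral_prod_right'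
  have hK := measurable_weightIntegrand hG
  rw [enumCampbell, lintegral_sum_measure]
  refine tsum_congr fun a => ?_
  have hrem := measurable_remove (E := 𝕏) a
  have hum : Measurable (unmark : Config ((𝕏 × ℝ≥0) × 𝕎) → _) := measurable_unmark
  have hum' : Measurable (unmark : Config (𝕏 × ℝ≥0) → _) := measurable_unmark
  have hI : Measurable fun c : Config ((𝕏 × ℝ≥0) × 𝕎) =>
      ∫⁻ u, weightIntegrand G (((((C.1, fun h => (c.2 (a h)).1.1, fun h => (c.2 (a h)).2, u),
          remove a (unmark (unmark c))), fun h => (c.2 (a h)).1.2),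
          fun j => (c.2 (complEnum a j)).1.2), fun j => (c.2 (complEnum a j)).2)
          ∂(auxMeasure n) :=
    (hK.comp (f := fun p : Config ((𝕏 × ℝ≥0) × 𝕎) × ℝ => (((((C.1,
      fun h => (p.1.2 (a h)).1.1, fun h => (p.1.2 (a h)).2, p.2),
      remove a (unmark (unmark p.1))), fun h => (p.1.2 (a h)).1.2),
      fun j => (p.1.2 (complEnum a j)).1.2), fun j => (p.1.2 (complEnum a j)).2))
      (by fun_prop)).lintegral_prod_right'
  have hI' := hI.indicator (measurableSet_forall_lt a)
  rw [lintegral_map hW (by fun_prop), lintegral_congr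
    fun c => prod_categorical_mul_lintegral hn hG C a c, lintegral_mark _ _ hI', lintegral_mark,
    ← lintegral_indicator (measurableSet_forall_lt a)]
  · refine lintegral_congr fun c => ?_
    by_cases ha : ∀ h, a h < c.1
    · rw [Set.indicator_of_mem (by exact ha)]
      refine Eq.trans (lintegral_congr fun s => lintegral_congr fun w =>
        Set.indicator_of_mem (by exact ha) _) ?_
      exact lintegral_marks_split (auxMeasure n) H F a
        (K := fun p : (((ℝ × (Fin k → 𝕎)) × (Fin k → ℝ≥0)) × (ℕ → ℝ≥0)) × (ℕ → 𝕎) =>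
          weightIntegrand G (((((C.1, fun h => c.2 (a h), p.1.1.1.2, p.1.1.1.1), remove a c),
            p.1.1.2), p.1.2), p.2)) (hK.comp (by fun_prop))
    · rw [Set.indicator_of_notMem (by exact ha)]
      refine Eq.trans (lintegral_congr fun s => lintegral_congr fun w =>
        Set.indicator_of_notMem (by exact ha) _) ?_
      simp
  · exact (hI'.comp measurable_attach).lintegral_prod_right'

theorem lintegral_modelOn (hn : 1 ≤ n) [StandardBorelSpace 𝕏]
    {P : Kernel (Fin k → 𝕏) (Config 𝕏)} (hP : IsReducedPalm Φ k P)
    [SigmaFinite (factorialMoment Φ k)]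
    {G : ((Fin n → ℕ) × (Fin k → 𝕏) × (Fin k → 𝕎) × ℝ) × Measure (𝕏 × 𝕎) → ℝ≥0∞}
    (hG : Measurable G) :
    ∫⁻ ω, G (conditioning k ω, randomMeasure ω) ∂(modelOn Φ H F f n k) =
      ∑' C : Allocation n k, ∫⁻ x, ∫⁻ u, ∫⁻ w,
        posteriorWeight (P x) H F (fun h => clusterSize C.1 h) x w u
          (fun μ => G ((C.1, x, w, u), μ))
        ∂(Measure.pi fun _ : Fin k => F) ∂(auxMeasure n) ∂(factorialMoment Φ k) := by
  have := hP.markov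
  -- The conditioning variables ignore the observations, so dummy ones in `Unit` express them as a
  -- function of the remaining coordinates.
  have hg : Measurable fun q : (Config ((𝕏 × ℝ≥0) × 𝕎) × (Fin n → ℕ)) × ℝ =>
      G (conditioning k ((q, fun _ => ()) : Sample 𝕏 𝕎 Unit n), markedAtomic q.1.1) :=
    hG.comp ((measurable_conditioning.comp (by fun_prop)).prodMk
      (measurable_markedAtomic.comp (by fun_prop)))
  refine (lintegral_modelOn_eq_tsum Φ H F f hg).trans (tsum_congr fun C => ?_)
  have hcond (a : Fin k ↪ ℕ) (c : Config ((𝕏 × ℝ≥0) × 𝕎)) (u : ℝ) :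
      conditioning k ((((c, C.labels a), u), fun _ => ()) : Sample 𝕏 𝕎 Unit n) =
        (C.1, fun h => (c.2 (a h)).1.1, fun h => (c.2 (a h)).2, u) := by
    simp only [conditioning, C.alloc_labels, C.getD_labels]
  simp only [hcond]
  rw [lintegral_labels Φ H F hn hG C]
  have hW : Measurable fun p : ((((Fin k → 𝕏) × Config 𝕏) × ℝ) × (Fin k → 𝕎)) =>
      configWeight H F G ((C.1, p.1.1.1, p.2, p.1.2), p.1.1.2) :=
    (measurable_configWeight H F hG).comp (by fun_prop)
  rw [hP.lintegral_enumCampbell (by exact hW.lintegral_prod_right'.lintegral_prod_right')]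
  swap
  · intro x c c' h
    exact lintegral_congr fun u => lintegral_congr fun w => configWeight_congr H F hG _ h
  refine lintegral_congr fun x => ?_
  rw [lintegral_lintegral_swap (Measurable.aemeasurable _)]
  · refine lintegral_congr fun u => ?_
    rw [lintegral_lintegral_swap (Measurable.aemeasurable _)]
    · rfl
    · exact hW.comp (f := fun p : Config 𝕏 × (Fin k → 𝕎) => (((x, p.1), u), p.2)) (by fun_prop)
  · exact (hW.comp (f := fun p : (Config 𝕏 × ℝ) × (Fin k → 𝕎) => (((x, p.1.1), p.1.2), p.2))
      (by fun_prop)).lintegral_prod_right'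

end model

/-! ### The posterior kernel -/

section posteriorKernel

variable {n k : ℕ} (P : Kernel (Fin k → 𝕏) (Config 𝕏)) [IsMarkovKernel P]
  (H : Measure ℝ≥0) [IsProbabilityMeasure H] (F : Measure 𝕎) [IsProbabilityMeasure F]

theorem measurable_posteriorWeight
    {G : ((Fin n → ℕ) × (Fin k → 𝕏) × (Fin k → 𝕎) × ℝ) × Measure (𝕏 × 𝕎) → ℝ≥0∞}
    (hG : Measurable G) :
    Measurable fun θ : (Fin n → ℕ) × (Fin k → 𝕏) × (Fin k → 𝕎) × ℝ =>
      posteriorWeight (P θ.2.1) H F (fun h => clusterSize θ.1 h) θ.2.1 θ.2.2.1 θ.2.2.2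
        (fun μ => G (θ, μ)) := by
  simp_rw [posteriorWeight_eq_lintegral_configWeight]
  exact (measurable_configWeight H F hG).lintegral_kernel_prod_right'
    (κ := P.comap (fun θ : (Fin n → ℕ) × (Fin k → 𝕏) × (Fin k → 𝕎) × ℝ => θ.2.1) (by fun_prop))

open Classical in
/-- The conditional law of the random measure given the conditioning variables. -/
noncomputable def posteriorKernel (hH : H {0} = 0) :
    Kernel ((Fin n → ℕ) × (Fin k → 𝕏) × (Fin k → 𝕎) × ℝ) (Measure (𝕏 × 𝕎)) where
  -- The value for `u ≤ 0` is arbitrary, since `U_n` is almost surely positive; a Dirac mass keeps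
  -- the kernel Markov.
  toFun θ := if 0 < θ.2.2.2 then posterior H F (fun h => clusterSize θ.1 h) θ.2.1 θ.2.2.1 θ.2.2.2
    (nonActive (P θ.2.1) H θ.2.2.2) else Measure.dirac 0
  measurable' := by
    refine Measure.measurable_of_measurable_coe _ fun s hs => ?_
    -- Measurability in all parameters is read off from the ratio of two weights, each an iterated
    -- integral of a jointly measurable function.
    have e : (fun θ : (Fin n → ℕ) × (Fin k → 𝕏) × (Fin k → 𝕎) × ℝ =>
        (if 0 < θ.2.2.2 then posterior H F (fun h => clusterSize θ.1 h) θ.2.1 θ.2.2.1 θ.2.2.2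
          (nonActive (P θ.2.1) H θ.2.2.2) else Measure.dirac 0) s) =
        fun θ => if 0 < θ.2.2.2 then
          (posteriorWeight (P θ.2.1) H F (fun h => clusterSize θ.1 h) θ.2.1 θ.2.2.1 θ.2.2.2 1)⁻¹ *
          posteriorWeight (P θ.2.1) H F (fun h => clusterSize θ.1 h) θ.2.1 θ.2.2.1 θ.2.2.2
            (s.indicator 1) else (Measure.dirac (0 : Measure (𝕏 × 𝕎))) s := by
      funext θ
      split_ifs with hu
      · rw [← lintegral_indicator_one hs, (posteriorWeight_eq_mul_lintegral _ H F _ _ _ hH hu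
          (measurable_one.indicator hs)).2]
      · rfl
    rw [e]
    refine Measurable.ite (measurableSet_lt (by fun_prop) (by fun_prop))
      (Measurable.mul (Measurable.inv ?_) ?_) measurable_const
    · exact measurable_posteriorWeight P H F measurable_one
    · exact measurable_posteriorWeight P H F
        (G := fun p => s.indicator 1 p.2) ((measurable_one.indicator hs).comp measurable_snd)

theorem posteriorKernel_apply (hH : H {0} = 0)
    {θ : (Fin n → ℕ) × (Fin k → 𝕏) × (Fin k → 𝕎) × ℝ} (hu : 0 < θ.2.2.2) :
    posteriorKernel P H F hH θ = posterior H F (fun h => clusterSize θ.1 h) θ.2.1 θ.2.2.1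
      θ.2.2.2 (nonActive (P θ.2.1) H θ.2.2.2) := if_pos hu

instance (hH : H {0} = 0) : IsMarkovKernel (posteriorKernel (n := n) P H F hH) := by
  refine ⟨fun θ => ?_⟩
  by_cases hu : 0 < θ.2.2.2
  · rw [posteriorKernel_apply P H F hH hu]
    have := isProbabilityMeasure_nonActive (P θ.2.1) H hu.le
    exact isProbabilityMeasure_posterior H F _ _ _ hH hu _
  · have : posteriorKernel P H F hH θ = Measure.dirac 0 := if_neg hu
    rw [this]
    infer_instance

variable (Φ : Measure (Config 𝕏)) [IsProbabilityMeasure Φ]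
    (f : Kernel (𝕏 × 𝕎) Z) [IsMarkovKernel f]

/-- The mixture formula is applied to the indicator of `s` and to the kernel mass of its sections.
For fixed `(C, x, w, u)` both weights equal the weight of `1` times the posterior mass of the
section. -/
theorem map_modelOn_eq_compProd [StandardBorelSpace 𝕏] (hn : 1 ≤ n) (hP : IsReducedPalm Φ k P)
    [SigmaFinite (factorialMoment Φ k)] (hH : H {0} = 0) :
    (modelOn Φ H F f n k).map (fun ω => (conditioning k ω, randomMeasure ω)) =
      ((modelOn Φ H F f n k).map (conditioning k)) ⊗ₘ posteriorKernel P H F hH := by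
  have hm : SFinite (modelOn Φ H F f n k) := by
    unfold modelOn model
    infer_instance
  have hc : Measurable (conditioning k : Sample 𝕏 𝕎 Z n → _) := measurable_conditioning
  ext s hs
  have hκ := Kernel.measurable_kernel_prodMk_left (κ := posteriorKernel P H F (n := n) hH) hs
  have h1 := lintegral_modelOn Φ H F f hn hP (G := s.indicator 1) (measurable_one.indicator hs)
  have h2 := lintegral_modelOn Φ H F f hn hP
    (G := fun p => posteriorKernel P H F hH p.1 (Prod.mk p.1 ⁻¹' s)) (hκ.comp measurable_fst)
  rw [Measure.compProd_apply hs, lintegral_map hκ hc, h2, ← lintegral_indicator_one hs,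
    lintegral_map (measurable_one.indicator hs) (hc.prodMk measurable_randomMeasure), h1]
  refine tsum_congr fun C => lintegral_congr fun x => lintegral_congr_ae ?_
  filter_upwards [ae_auxMeasure n] with u hu
  refine lintegral_congr fun w => ?_
  have hsec : MeasurableSet (Prod.mk (C.1, x, w, u) ⁻¹' s) := measurable_prodMk_left hs
  rw [(posteriorWeight_eq_mul_lintegral (P x) H F (fun h => clusterSize C.1 h) x w hH hu
      (g := fun μ => s.indicator 1 ((C.1, x, w, u), μ))
      (by exact (measurable_one.indicator hs).comp measurable_prodMk_left)).1,
    (posteriorWeight_eq_mul_lintegral (P x) H F (fun h => clusterSize C.1 h) x w hH hu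
      (g := fun _ => posteriorKernel P H F hH (C.1, x, w, u) (Prod.mk (C.1, x, w, u) ⁻¹' s))
      measurable_const).1, lintegral_const]
  have := isProbabilityMeasure_nonActive (P x) H hu.le
  have := isProbabilityMeasure_posterior H F (fun h => clusterSize C.1 h) x w hH hu
    (nonActive (P x) H u)
  rw [measure_univ, mul_one, posteriorKernel_apply P H F hH hu, ← lintegral_indicator_one hsec]
  rfl

theorem ae_map_conditioning [StandardBorelSpace 𝕏] (hn : 1 ≤ n) (hP : IsReducedPalm Φ k P)
    [SigmaFinite (factorialMoment Φ k)] (hΦ : IsSimple Φ) :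
    ∀ᵐ θ ∂((modelOn Φ H F f n k).map (conditioning k)), 0 < θ.2.2.2 ∧ IsSimple (P θ.2.1) := by
  have hs : MeasurableSet {θ : (Fin n → ℕ) × (Fin k → 𝕏) × (Fin k → 𝕎) × ℝ |
      0 < θ.2.2.2 ∧ IsSimple (P θ.2.1)} := by
    refine (measurableSet_lt (f := fun _ => (0 : ℝ)) (g := fun θ : (Fin n → ℕ) × (Fin k → 𝕏) ×
      (Fin k → 𝕎) × ℝ => θ.2.2.2) measurable_const (by fun_prop)).inter ?_
    exact (P.measurable_coe IsReducedPalm.measurableSet_injOn.compl).comp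
      (f := fun θ : (Fin n → ℕ) × (Fin k → 𝕏) × (Fin k → 𝕎) × ℝ => θ.2.1) (by fun_prop)
      (measurableSet_singleton 0)
  have hi : Measurable ({θ : (Fin n → ℕ) × (Fin k → 𝕏) × (Fin k → 𝕎) × ℝ |
      0 < θ.2.2.2 ∧ IsSimple (P θ.2.1)}ᶜ.indicator (1 : (Fin n → ℕ) × (Fin k → 𝕏) × (Fin k → 𝕎) × ℝ → ℝ≥0∞)) :=
    measurable_one.indicator hs.compl
  change _ = 0
  rw [← lintegral_indicator_one hs.compl, lintegral_map hi measurable_conditioning,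
    lintegral_modelOn Φ H F f hn hP (G := fun p => {θ : (Fin n → ℕ) × (Fin k → 𝕏) ×
      (Fin k → 𝕎) × ℝ | 0 < θ.2.2.2 ∧ IsSimple (P θ.2.1)}ᶜ.indicator 1 p.1)
      (hi.comp measurable_fst), ENNReal.tsum_eq_zero]
  intro C
  refine lintegral_eq_zero_of_ae_eq_zero ?_
  filter_upwards [hP.ae_isSimple hΦ] with x hx
  refine lintegral_eq_zero_of_ae_eq_zero ?_
  filter_upwards [ae_auxMeasure n] with u hu
  refine (lintegral_congr fun w => ?_).trans lintegral_zero
  have h0 : {θ : (Fin n → ℕ) × (Fin k → 𝕏) × (Fin k → 𝕎) × ℝ |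
      0 < θ.2.2.2 ∧ IsSimple (P θ.2.1)}ᶜ.indicator (1 : (Fin n → ℕ) × (Fin k → 𝕏) × (Fin k → 𝕎) × ℝ → ℝ≥0∞) (C.1, x, w, u) = 0 :=
    Set.indicator_of_notMem (by simp [hu, hx]) _
  simp only [h0, posteriorWeight, mul_zero, lintegral_zero]

end posteriorKernel

end MixtureModel

theorem mainTheorem12
    {𝕏 𝕎 Z : Type*}
    [TopologicalSpace 𝕏] [PolishSpace 𝕏] [MeasurableSpace 𝕏] [BorelSpace 𝕏]
    [TopologicalSpace 𝕎] [PolishSpace 𝕎] [MeasurableSpace 𝕎] [BorelSpace 𝕎]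
    [TopologicalSpace Z] [PolishSpace Z] [MeasurableSpace Z] [BorelSpace Z]
    (Φ : Measure (MixtureModel.Config 𝕏)) [IsProbabilityMeasure Φ]
    (hΦ : MixtureModel.IsSimple Φ)
    (H : Measure ℝ≥0) [IsProbabilityMeasure H] (hH : H {0} = 0)
    (F : Measure 𝕎) [IsProbabilityMeasure F]
    (f : Kernel (𝕏 × 𝕎) Z) [IsMarkovKernel f]
    (n : ℕ) (hn : 1 ≤ n) (k : ℕ)
    (hM : SigmaFinite (MixtureModel.factorialMoment Φ k)) :
    (∃ P : Kernel (Fin k → 𝕏) (MixtureModel.Config 𝕏), MixtureModel.IsReducedPalm Φ k P) ∧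
    ∀ P : Kernel (Fin k → 𝕏) (MixtureModel.Config 𝕏), MixtureModel.IsReducedPalm Φ k P →
      ∃ κ : Kernel ((Fin n → ℕ) × (Fin k → 𝕏) × (Fin k → 𝕎) × ℝ) (Measure (𝕏 × 𝕎)),
        IsMarkovKernel κ ∧
        -- `κ` is the conditional law of the random measure given the conditioning variables
        (MixtureModel.modelOn Φ H F f n k).map
            (fun ω => (MixtureModel.conditioning k ω, MixtureModel.randomMeasure ω)) =
          ((MixtureModel.modelOn Φ H F f n k).map (MixtureModel.conditioning k)) ⊗ₘ κ ∧
        ∀ᵐ θ ∂((MixtureModel.modelOn Φ H F f n k).map (MixtureModel.conditioning k)),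
          ∃ τ : Measure (MixtureModel.Config (𝕏 × ℝ≥0)),
            MixtureModel.IsNonActive (P θ.2.1) H θ.2.2.2 τ ∧
            κ θ = MixtureModel.posterior H F (fun h => MixtureModel.clusterSize θ.1 h)
              θ.2.1 θ.2.2.1 θ.2.2.2 τ := by
  -- Even an empty configuration carries a full sequence of irrelevant entries, so the existence of
  -- `Φ` forces a point of `𝕏`.
  have hX : Nonempty 𝕏 := (Measure.nonempty_of_neZero Φ).map fun c => c.2 0
  refine ⟨MixtureModel.exists_isReducedPalm Φ k, fun P hP => ?_⟩
  have := hP.markov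
  refine ⟨MixtureModel.posteriorKernel P H F hH, inferInstance,
    MixtureModel.map_modelOn_eq_compProd P H F Φ f hn hP hH, ?_⟩
  filter_upwards [MixtureModel.ae_map_conditioning P H F Φ f hn hP hΦ] with θ hθ
  exact ⟨_, MixtureModel.isNonActive_nonActive (P θ.2.1) H hθ.2 hH hθ.1.le,
    MixtureModel.posteriorKernel_apply P H F hH hθ.1⟩
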